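/- **Setting.** Let $m\in\mathbb N$, let $\mathfrak F$ be a set of probability measures on a measurable space $\mathcal X$, let $H_1,\dots,H_m$ be null hypotheses (submodels of $\mathfrak F$), and let $p_1,\dots,p_m:\mathcal X\to[0,1]$ be measurable ($p$-values). For $\mu\in\mathfrak F$ put $\mathcal H_0=\mathcal H_0(\mu)=\{i:\mu\in H_i\}$ and $m_0=|\mathcal H_0|$. Assume that * (independence under the null) for every $\mu\in\mathfrak F$ the variables $p_i$, $i\in\mathcal H_0(\mu)$, are mutually independent under $\mu$; * (stochastic heterogeneous lower bound) $F_1,\dots,F_m:\mathbb R\to\mathbb R$ are known nondecreasing functions, nonnegative on $[0,1]$, with $\mu(p_i\le x)\le F_i(x)$ for all $\mu\in\mathfrak F$, $i\in\mathcal H_0(\mu)$, $x\in\mathbb R$. Let $\alpha\in(0,1]$ and $\tilde\lambda_\alpha=\sqrt{(1+\log(1/\alpha))/2}$. For a vector $x\in\mathbb R^m$ write $x_{(1)}\le\dots\le x_{(m)}$ for its order statistics and $x_{[1]}\ge\dots\ge x_{[m]}$ for its reverse order statistics. Let $\mathbf F(t)=(F_i(t))_{1\le i\le m}$, $\mathbb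 G(t)=(\mathbf 1\{p_i\le t\}-F_i(t))_{1\le i\le m}$ and $i_{\mathcal H_0}(t)=|\{i\in\mathcal H_0:p_i\le t\}|$. Let $\mu\in\mathfrak F$ and let $X$, defined on a probability space $(\Omega,\Sigma,\mathbb P)$, have law $\mu$; all $p$-values below are evaluated at $X$. **Proposition (adaptive plug-in Bretagnolle inequality).** Let $\hat m_0$ be any estimator with values in $\{0,\dots,m\}$ such that $$\Big\{\sup_{t\in[0,1]}\sum_{k\in\mathcal H_0}\mathbb G_k(t)\le\sqrt{m_0}\,\tilde\lambda_\alpha\Big\}\subseteq\{m_0\le\hat m_0\}.$$ Then $$\mathbb P\Big(\exists t\in[0,1]:\ i_{\mathcal H_0}(t)>\sum_{1\le k\le\hat m_0}(\mathbf F(t))_{[k]}+\sqrt{\hat m_0}\,\tilde\lambda_\alpha\Big)\le\alpha.$$ **Theorem (adaptive top-$k$ bound).** Let $\hat m_0$ now be the Bretagnolle shortcut estimator $$\hat m_0=\max\Big\{n\in\{0,\dots,m\}:\ \forall t\in[0,1],\ \sum_{1\le j\le n}(\mathbb G(t))_{(j)}\le\tilde\lambda_\alpha\sqrt n\Big\}.$$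 Let $\sigma$ be a (random) permutation of $\{1,\dots,m\}$ that sorts the $p$-values, $p_{\sigma(1)}\le\dots\le p_{\sigma(m)}$, and for $1\le k\le m$ let $R_k=\{\sigma(1),\dots,\sigma(k)\}$ and $$\zeta_k=k\wedge\hat m_0\wedge\Big\lfloor\sum_{1\le i\le\hat m_0}\big(\mathbf F(p_{(k)})\big)_{[i]}+\sqrt{\hat m_0}\,\tilde\lambda_\alpha\Big\rfloor.$$ Then the interpolation bound $\hat V(S)=\max\{|S\cap A|:A\subseteq\{1,\dots,m\},\ |R_k\cap A|\le\zeta_k\text{ for all }k\}$ is a simultaneous confidence bound of level $\alpha$ on the number of false discoveries: $$\mathbb P\big(\forall S\subseteq\{1,\dots,m\}:\ |S\cap\mathcal H_0|\le\hat V(S)\big)\ge1-\alpha.$$ -/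

import Mathlib

open MeasureTheory ProbabilityTheory

namespace FDBound

noncomputable section

open scoped Classical

/- Vectors `(x₁, …, x_m)` are functions `Fin m → ℝ`, so that the one-based position `k` of the
mathematical text is the element of `Fin m` whose value is `k - 1`. -/

/-- The order statistics `x₍₁₎ ≤ … ≤ x₍ₘ₎`. -/
def orderStat {m : ℕ} (x : Fin m → ℝ) (j : Fin m) : ℝ := x (Tuple.sort x j)

/-- The reverse order statistics `x_[1] ≥ … ≥ x_[m]`. -/
def revOrderStat {m : ℕ} (x : Fin m → ℝ) (j : Fin m) : ℝ := orderStat x j.rev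

/-- The constant `√((1 + log (1/α)) / 2)`. -/
def lam (α : ℝ) : ℝ := √((1 + Real.log (1 / α)) / 2)

/-- The vector `G(t)`, with coordinates `1{q_i ≤ t} - F_i(t)`, for the vector `q` of p-values. -/
def G {m : ℕ} (F : Fin m → ℝ → ℝ) (q : Fin m → ℝ) (t : ℝ) : Fin m → ℝ :=
  fun i => (if q i ≤ t then 1 else 0) - F i t

/-- The number `i_A(t)` of indices `i ∈ A` with `q_i ≤ t`. -/
def countLE {m : ℕ} (q : Fin m → ℝ) (A : Finset (Fin m)) (t : ℝ) : ℕ :=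
  (A.filter fun i => q i ≤ t).card

/-- The plug-in envelope `∑_{1 ≤ k ≤ n} F(t)_[k] + √n λ`. -/
def envelope {m : ℕ} (F : Fin m → ℝ → ℝ) (α : ℝ) (n : ℕ) (t : ℝ) : ℝ :=
  (∑ j ∈ Finset.univ.filter (fun j : Fin m => (j : ℕ) < n),
      revOrderStat (fun i => F i t) j) + √(n : ℝ) * lam α

/-- The shortcut estimator of the number of true nulls: the largest `n ∈ {0, …, m}` such that
`∑_{1 ≤ j ≤ n} G(t)₍ⱼ₎ ≤ λ √n` for all `t ∈ [0, 1]` (the value `n = 0` always qualifies). -/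
def mHat {m : ℕ} (F : Fin m → ℝ → ℝ) (α : ℝ) (q : Fin m → ℝ) : ℕ :=
  ((Finset.range (m + 1)).filter fun n : ℕ =>
    ∀ t ∈ Set.Icc (0 : ℝ) 1,
      ∑ j ∈ Finset.univ.filter (fun j : Fin m => (j : ℕ) < n),
        orderStat (G F q t) j ≤ lam α * √(n : ℝ)).sup id

/-- The top-`k` set `{σ(1), …, σ(k)}`. -/
def topSet {m : ℕ} (σ : Equiv.Perm (Fin m)) (k : Fin m) : Finset (Fin m) :=
  (Finset.univ.filter fun j : Fin m => j ≤ k).image σ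

/-- The bound `k ∧ m̂₀ ∧ ⌊∑_{1 ≤ i ≤ m̂₀} F(q₍ₖ₎)_[i] + √m̂₀ λ⌋`. -/
def zeta {m : ℕ} (F : Fin m → ℝ → ℝ) (α : ℝ) (q : Fin m → ℝ) (k : Fin m) : ℕ :=
  min ((k : ℕ) + 1) (min (mHat F α q) ⌊envelope F α (mHat F α q) (orderStat q k)⌋₊)

/-- The interpolation bound `max {|S ∩ A| : |R_k ∩ A| ≤ ζ_k for all k}` of a reference family
`(R_k, ζ_k)` (the set `A = ∅` always qualifies). -/
def jerBound {m : ℕ} {κ : Type*} (R : κ → Finset (Fin m)) (ζ : κ → ℕ)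
    (S : Finset (Fin m)) : ℕ :=
  (Finset.univ.filter fun A : Finset (Fin m) => ∀ k, (R k ∩ A).card ≤ ζ k).sup
    fun A => (S ∩ A).card

variable {𝓧 : Type*} [MeasurableSpace 𝓧]

/-- The set of indices of the null hypotheses that are true under `μ`. -/
def trueNulls {m : ℕ} (H : Fin m → Set (ProbabilityMeasure 𝓧)) (μ : ProbabilityMeasure 𝓧) :
    Finset (Fin m) :=
  Finset.univ.filter fun i => μ ∈ H i

/-- Independence under the null: for each `μ` in the model, the p-values with index in the set of
true nulls are mutually independent. -/
def IndepUnderNull {m : ℕ} (𝔉 : Set (ProbabilityMeasure 𝓧))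
    (H : Fin m → Set (ProbabilityMeasure 𝓧)) (p : Fin m → 𝓧 → ℝ) : Prop :=
  ∀ μ ∈ 𝔉, iIndepFun (fun i : trueNulls H μ => p i) (μ : Measure 𝓧)

/-- Stochastic heterogeneous lower bound: each `F_i` is nondecreasing, and it dominates the cdf of
the `i`-th p-value under every `μ` of the model for which the `i`-th null hypothesis is true. -/
def HeterogeneousBound {m : ℕ} (𝔉 : Set (ProbabilityMeasure 𝓧))
    (H : Fin m → Set (ProbabilityMeasure 𝓧)) (p : Fin m → 𝓧 → ℝ) (F : Fin m → ℝ → ℝ) : Prop :=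
  (∀ i, Monotone (F i)) ∧
    ∀ μ ∈ 𝔉, ∀ i ∈ trueNulls H μ, ∀ x : ℝ, (μ : Measure 𝓧).real {y | p i y ≤ x} ≤ F i x

/-- With probability at least `1 - α`, the bound `V̂(S)` is at least the number `|S ∩ H₀|` of false
discoveries simultaneously for all `S`.  The second clause is the same statement for the
complementary event; it is written out so that nothing hinges on the measurability of `V̂`
(measures of non-measurable sets being outer measures). -/
def IsFDConfidenceBound {m : ℕ} {Ω : Type*} [MeasurableSpace Ω] (P : Measure Ω)
    (H₀ : Finset (Fin m)) (α : ℝ) (V : Ω → Finset (Fin m) → ℕ) : Prop :=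
  ENNReal.ofReal (1 - α) ≤ P {ω | ∀ S : Finset (Fin m), (S ∩ H₀).card ≤ V ω S} ∧
    P {ω | ∃ S : Finset (Fin m), V ω S < (S ∩ H₀).card} ≤ ENNReal.ofReal α

end

end FDBound

/-!
Everything rests on one event: that `∑_{k ∈ H₀} G_k(t) ≤ √m₀ λ` for all `t ∈ [0, 1]`.  Off this
event, and only there, the bounds can fail.  On it, replacing the sum of `F_k(t)` over the true
nulls by the sum of the largest values gives the plug-in envelope (`countLE_le_envelope`); the sum
of the `m₀` smallest coordinates of `G(t)` is at most the sum over the true nulls, so the shortcut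
estimator is at least `m₀` (`card_le_mHat`); hence the set of true nulls satisfies all constraints
`|R_k ∩ A| ≤ ζ_k` (`card_topSet_inter_le_zeta`) and competes in the maximum that defines the
interpolation bound.

What remains is Bretagnolle's inequality for independent, not identically distributed variables, in
its one-sided form with constant `e`: the event fails with probability at most
`exp (1 - 2 x² / n)`, where `n = m₀` and `x = √n λ` (`exists_bretagnolle_event`).

*Discretization.*  If the process exceeds `x` at `t` and `k` points lie in `[0, t]`, then
`∑ F_i(t) < k - x`.  The sets `lowSet F x k = {s ∈ [0, 1] | ∑ F_i(s) < k - x}` increase with `k`,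
and the expected number of points in the `k`-th set is at most `k - x`.  Only the index of the
first of these sets that contains a point matters, so that the problem concerns independent points
in finitely many cells (`crossing_prob_le_exp`).

*Reduction to identical distributions.*  Let `D` be the maximum over `x < k ≤ n` of the number of
points in the cells up to `k`, minus `k`.  For every `d ≥ 1`, the indicator of `D ≥ 0` is at most
`(D + d)⁺ / d`.  As a function of the positions `c`, `c'` of any two of the points, `(D + d)⁺` has
the form `l + α(c) + α(c') + β(c) β(c')` (`exists_pair_form`), and is therefore positive
semidefinite on weights of sum zero.  Hence replacing two of the distributions by their average does
not decrease the expectation of `(D + d)⁺`, and by compactness the expectation is largest if all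
distributions are equal to their mean (`prodSum_le_prodSum_const`).

*Identical distributions.*  The expectation of `(D + d)⁺` is a sum of probabilities that an
empirical process crosses a boundary at the levels `v = x - d + t`, `t ≥ 1`.  Revealing the points
cell by cell, such a probability is bounded by means of a superharmonic functional of the remaining
mass `z` and the number `R` of remaining points (`crossing_prob_le`).  The functional
`(z - v) ^ R` gives `(1 - v / n) ^ v`, which suffices for `v ≥ 4 n / 5`.  For smaller `v`, the
Beta integral `∫₀^{z - κ} s ^ (y - 1) (z - κ - s) ^ R ds` with `κ = (2 v - 1) / 3` and
`y = 4 v / 3 - 1 / 2` gives `exp (-(2 v² - 1.19 v) / n)` (`iid_crossing_le`); this uses that its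
logarithm, normalized by `z ^ R`, is monotone along the boundary and almost so along the diagonal.
Both facts are inequalities between smooth functions that are concave and vanish at infinity
(`logStep_boundary_le`, `logStep_diagonal_le`).  Summing over `t` and choosing `d` close to
`n / (4 x)` gives the constant `e` (`exists_level_sum_le`).
-/

namespace FDBound

open Filter Topology Finset

/-! ### Elementary inequalities for the increments of the test functional -/

lemma nonpos_of_concaveOn_of_tendsto_zero {f : ℝ → ℝ} {a x : ℝ} (hf : ConcaveOn ℝ (Set.Ici a) f)
    (hlim : Tendsto f atTop (𝓝 0)) (hx : a ≤ x) : f x ≤ 0 := by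
  have h1 : Tendsto (fun y : ℝ => 2 * f y - f (2 * y - x)) atTop (𝓝 (2 * 0 - 0)) := by
    refine (hlim.const_mul 2).sub (hlim.comp ?_)
    refine tendsto_atTop_add_const_right _ (-x) ?_
    exact tendsto_id.const_mul_atTop (by norm_num)
  rw [mul_zero, sub_zero] at h1
  refine ge_of_tendsto h1 ?_
  filter_upwards [eventually_ge_atTop x] with y hy
  have h2 := hf.2 (Set.mem_Ici.2 hx) (Set.mem_Ici.2 (by linarith : a ≤ 2 * y - x))
    (by norm_num : (0 : ℝ) ≤ 1 / 2) (by norm_num : (0 : ℝ) ≤ 1 / 2) (by norm_num)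
  simp only [smul_eq_mul] at h2
  have h3 : 1 / 2 * x + 1 / 2 * (2 * y - x) = y := by ring
  rw [h3] at h2
  linarith

/-- The function `(w + c) log (1 + 1/w) - log (1 + c/w)`, in terms of which the increments of the
logarithm of the test functional are expressed. -/
noncomputable def logStep (c w : ℝ) : ℝ :=
  (w + c) * (Real.log (w + 1) - Real.log w) + Real.log w - Real.log (w + c)

/-- The derivative of `logStep c`. -/
noncomputable def logStepDeriv (c w : ℝ) : ℝ :=
  Real.log (w + 1) - Real.log w + (1 - c) / w + (c - 1) / (w + 1) - 1 / (w + c)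

/-- The second derivative of `logStep c`. -/
noncomputable def logStepDeriv2 (c w : ℝ) : ℝ :=
  ((w + c) ^ 2 * ((c - 1) * (2 * w + 1) - w ^ 2 - w) + w ^ 2 * (w + 1) ^ 2) /
    (w ^ 2 * (w + 1) ^ 2 * (w + c) ^ 2)

lemma hasDerivAt_logStep {c w : ℝ} (hw : 0 < w) (hc : 0 < w + c) :
    HasDerivAt (logStep c) (logStepDeriv c w) w := by
  have h1 : HasDerivAt (fun w : ℝ => Real.log (w + 1)) (1 / (w + 1)) w :=
    ((hasDerivAt_id w).add_const 1).log (by simp; positivity)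
  have h2 : HasDerivAt (fun w : ℝ => Real.log w) (1 / w) w :=
    (hasDerivAt_id w).log (by simp; positivity)
  have h3 : HasDerivAt (fun w : ℝ => Real.log (w + c)) (1 / (w + c)) w :=
    ((hasDerivAt_id w).add_const c).log (by simp; positivity)
  have h4 := ((((hasDerivAt_id w).add_const c).mul (h1.sub h2)).add h2).sub h3
  refine h4.congr_deriv ?_
  simp only [logStepDeriv, id, Pi.sub_apply]
  field_simp
  ring

lemma hasDerivAt_logStepDeriv {c w : ℝ} (hw : 0 < w) (hc : 0 < w + c) :
    HasDerivAt (logStepDeriv c) (logStepDeriv2 c w) w := by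
  have h1 : HasDerivAt (fun w : ℝ => Real.log (w + 1)) (1 / (w + 1)) w :=
    ((hasDerivAt_id w).add_const 1).log (by simp; positivity)
  have h2 : HasDerivAt (fun w : ℝ => Real.log w) (1 / w) w :=
    (hasDerivAt_id w).log (by simp; positivity)
  have e1 : HasDerivAt (fun w : ℝ => (1 - c) / w) ((0 * w - (1 - c) * 1) / w ^ 2) w :=
    (hasDerivAt_const w (1 - c)).div (hasDerivAt_id w) hw.ne'
  have e2 : HasDerivAt (fun w : ℝ => (c - 1) / (w + 1))
      ((0 * (w + 1) - (c - 1) * 1) / (w + 1) ^ 2) w :=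
    (hasDerivAt_const w (c - 1)).div ((hasDerivAt_id w).add_const 1) (by simp; positivity)
  have e4 : HasDerivAt (fun w : ℝ => 1 / (w + c)) ((0 * (w + c) - 1 * 1) / (w + c) ^ 2) w :=
    (hasDerivAt_const w (1 : ℝ)).div ((hasDerivAt_id w).add_const c) hc.ne'
  have h4 := ((((h1.sub h2).add e1).add e2).sub e4)
  refine h4.congr_deriv ?_
  have : w + 1 ≠ 0 := by positivity
  rw [logStepDeriv2]
  field_simp
  ring

lemma tendsto_logStep (c : ℝ) : Tendsto (logStep c) atTop (𝓝 1) := by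
  have h1 := Real.tendsto_mul_log_one_add_div_atTop 1
  have h0 : Tendsto (fun w : ℝ => 1 / w) atTop (𝓝 0) := tendsto_const_nhds.div_atTop tendsto_id
  have hc0 : Tendsto (fun w : ℝ => c / w) atTop (𝓝 0) := tendsto_const_nhds.div_atTop tendsto_id
  have h2 : Tendsto (fun w : ℝ => Real.log (1 + 1 / w)) atTop (𝓝 0) := by
    simpa using (tendsto_const_nhds.add h0).log (by norm_num : (1 : ℝ) + 0 ≠ 0)
  have h3 : Tendsto (fun w : ℝ => Real.log (1 + c / w)) atTop (𝓝 0) := by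
    simpa using (tendsto_const_nhds.add hc0).log (by norm_num : (1 : ℝ) + 0 ≠ 0)
  have h4 := (h1.add (h2.const_mul c)).sub h3
  rw [mul_zero, add_zero, sub_zero] at h4
  refine h4.congr' ?_
  filter_upwards [eventually_gt_atTop 0, eventually_gt_atTop (-c)] with w hw hwc
  have e1 : Real.log (1 + 1 / w) = Real.log (w + 1) - Real.log w := by
    rw [← Real.log_div (by positivity) hw.ne']; congr 1; field_simp
  have e2 : Real.log (1 + c / w) = Real.log (w + c) - Real.log w := by
    rw [← Real.log_div (by linarith) hw.ne']; congr 1; field_simp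
  rw [e1, e2, logStep]
  ring

/-- For `κ = (2 v - 1) / 3` and `y = 4 v / 3 - 1 / 2`, the difference of the two sides is the
increment of `m ↦ logBeta κ y (m + v) m` at `m = z - v`: the normalized functional decreases along
the boundary.  The difference is concave in `z` and tends to `0` at infinity. -/
lemma logStep_boundary_le {v z : ℝ} (hv : 1 ≤ v) (hz : v ≤ z) :
    logStep (v + 1 / 6) (z - (2 * v - 1) / 3) ≤ logStep (1 - v) z := by
  suffices h : logStep (v + 1 / 6) (z - (2 * v - 1) / 3) - logStep (1 - v) z ≤ 0 by linarith
  have hpos : ∀ y ∈ Set.Ici v, 0 < y ∧ 0 < y + (1 - v) ∧ 0 < y - (2 * v - 1) / 3 ∧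
      0 < y - (2 * v - 1) / 3 + (v + 1 / 6) := by
    intro y hy
    have hy' : v ≤ y := hy
    refine ⟨?_, ?_, ?_, ?_⟩ <;> linarith
  have hshift (y : ℝ) : HasDerivAt (fun y : ℝ => y - (2 * v - 1) / 3) 1 y :=
    (hasDerivAt_id y).sub_const _
  have hconc : ConcaveOn ℝ (Set.Ici v) fun z =>
      logStep (v + 1 / 6) (z - (2 * v - 1) / 3) - logStep (1 - v) z := by
    refine concaveOn_of_hasDerivWithinAt2_nonpos (convex_Ici v)
      (f' := fun z => logStepDeriv (v + 1 / 6) (z - (2 * v - 1) / 3) * 1 -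
        logStepDeriv (1 - v) z) ?_ ?_ (fun y hy => ?_) (fun y hy => ?_)
      (f'' := fun z => logStepDeriv2 (v + 1 / 6) (z - (2 * v - 1) / 3) * 1 * 1 -
        logStepDeriv2 (1 - v) z)
    · intro y hy
      obtain ⟨h1, h2, h3, h4⟩ := hpos y hy
      exact (((hasDerivAt_logStep h3 h4).comp y (hshift y)).sub
        (hasDerivAt_logStep h1 h2)).continuousAt.continuousWithinAt
    · intro y hy
      obtain ⟨h1, h2, h3, h4⟩ := hpos y (interior_subset hy)
      exact (((hasDerivAt_logStep h3 h4).comp y (hshift y)).sub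
        (hasDerivAt_logStep h1 h2)).hasDerivWithinAt
    · obtain ⟨h1, h2, h3, h4⟩ := hpos y (interior_subset hy)
      exact ((((hasDerivAt_logStepDeriv h3 h4).comp y (hshift y)).mul_const 1).sub
        (hasDerivAt_logStepDeriv h1 h2)).hasDerivWithinAt
    · obtain ⟨h1, h2, h3, h4⟩ := hpos y (interior_subset hy)
      have hy' : v ≤ y := interior_subset hy
      simp only [mul_one, logStepDeriv2]
      rw [sub_nonpos, div_le_div_iff₀ (by positivity) (by positivity), ← sub_nonneg]
      obtain ⟨s, rfl⟩ : ∃ s, v = 1 + s := ⟨v - 1, by ring⟩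
      obtain ⟨t, rfl⟩ : ∃ t, y = 1 + s + t := ⟨y - (1 + s), by ring⟩
      have hs : 0 ≤ s := by linarith
      have ht : 0 ≤ t := by linarith
      clear h1 h2 h3 h4 hy' hy hv hz hpos hshift
      ring_nf
      positivity
  refine nonpos_of_concaveOn_of_tendsto_zero (x := z) hconc ?_ hz
  have := ((tendsto_logStep (v + 1 / 6)).comp
    (tendsto_atTop_add_const_right _ (-((2 * v - 1) / 3)) tendsto_id)).sub
    (tendsto_logStep (1 - v))
  simpa [sub_eq_add_neg, Function.comp_def] using this

/-- For `κ = (2 v - 1) / 3` and `y = 4 v / 3 - 1 / 2`, the left side is minus the increment of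
`m ↦ logBeta κ y m m`: adding `(2 v² - 1.19 v) / m` makes the diagonal values of the normalized
functional increase in `m`. -/
lemma logStep_diagonal_le {v m : ℝ} (hv : 1 ≤ v) (hm : 5 / 4 * v ≤ m) :
    logStep 0 m - logStep (2 * v + 1 / 6) (m - (2 * v - 1) / 3) ≤
      -((2 * v ^ 2 - 119 / 100 * v) / m) + (2 * v ^ 2 - 119 / 100 * v) / (m + 1) := by
  set q : ℝ := 2 * v ^ 2 - 119 / 100 * v with hq
  suffices h : logStep 0 m - logStep (2 * v + 1 / 6) (m - (2 * v - 1) / 3) +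
      q * (1 / m - 1 / (m + 1)) ≤ 0 by
    have : q * (1 / m - 1 / (m + 1)) = q / m - q / (m + 1) := by ring
    linarith
  have hpos : ∀ y ∈ Set.Ici (5 / 4 * v), 0 < y ∧ 0 < y + 0 ∧ 0 < y - (2 * v - 1) / 3 ∧
      0 < y - (2 * v - 1) / 3 + (2 * v + 1 / 6) := by
    intro y hy
    have hy' : 5 / 4 * v ≤ y := hy
    refine ⟨?_, ?_, ?_, ?_⟩ <;> linarith
  have hshift (y : ℝ) : HasDerivAt (fun y : ℝ => y - (2 * v - 1) / 3) 1 y :=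
    (hasDerivAt_id y).sub_const _
  have hr1 (y : ℝ) (hy : 0 < y) : HasDerivAt (fun y : ℝ => q * (1 / y - 1 / (y + 1)))
      (q * (1 / (y + 1) ^ 2 - 1 / y ^ 2)) y := by
    have e1 : HasDerivAt (fun y : ℝ => 1 / y) ((0 * y - 1 * 1) / y ^ 2) y :=
      (hasDerivAt_const y (1 : ℝ)).div (hasDerivAt_id y) hy.ne'
    have e2 : HasDerivAt (fun y : ℝ => 1 / (y + 1)) ((0 * (y + 1) - 1 * 1) / (y + 1) ^ 2) y :=
      (hasDerivAt_const y (1 : ℝ)).div ((hasDerivAt_id y).add_const 1) (by simp; positivity)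
    refine ((e1.sub e2).const_mul q).congr_deriv ?_
    ring
  have hr2 (y : ℝ) (hy : 0 < y) : HasDerivAt (fun y : ℝ => q * (1 / (y + 1) ^ 2 - 1 / y ^ 2))
      (q * (2 / y ^ 3 - 2 / (y + 1) ^ 3)) y := by
    have e1 := (hasDerivAt_const y (1 : ℝ)).div ((hasDerivAt_id y).pow 2) (by simp; positivity)
    have e2 := (hasDerivAt_const y (1 : ℝ)).div (((hasDerivAt_id y).add_const (1 : ℝ)).pow 2)
      (by simp; positivity)
    refine ((e2.sub e1).const_mul q).congr_deriv ?_
    simp only [id, Pi.pow_apply]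
    field_simp
    ring
  have hconc : ConcaveOn ℝ (Set.Ici (5 / 4 * v)) fun m =>
      logStep 0 m - logStep (2 * v + 1 / 6) (m - (2 * v - 1) / 3) +
        q * (1 / m - 1 / (m + 1)) := by
    refine concaveOn_of_hasDerivWithinAt2_nonpos (convex_Ici _)
      (f' := fun m => logStepDeriv 0 m -
        logStepDeriv (2 * v + 1 / 6) (m - (2 * v - 1) / 3) * 1 +
        q * (1 / (m + 1) ^ 2 - 1 / m ^ 2)) ?_ ?_ (fun y hy => ?_) (fun y hy => ?_)
      (f'' := fun m => logStepDeriv2 0 m -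
        logStepDeriv2 (2 * v + 1 / 6) (m - (2 * v - 1) / 3) * 1 * 1 +
        q * (2 / m ^ 3 - 2 / (m + 1) ^ 3))
    · intro y hy
      obtain ⟨h1, h2, h3, h4⟩ := hpos y hy
      exact (((hasDerivAt_logStep h1 h2).sub
        ((hasDerivAt_logStep h3 h4).comp y (hshift y))).add
        (hr1 y h1)).continuousAt.continuousWithinAt
    · intro y hy
      obtain ⟨h1, h2, h3, h4⟩ := hpos y (interior_subset hy)
      exact (((hasDerivAt_logStep h1 h2).sub
        ((hasDerivAt_logStep h3 h4).comp y (hshift y))).add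
        (hr1 y h1)).hasDerivWithinAt
    · obtain ⟨h1, h2, h3, h4⟩ := hpos y (interior_subset hy)
      exact (((hasDerivAt_logStepDeriv h1 h2).sub
        (((hasDerivAt_logStepDeriv h3 h4).comp y (hshift y)).mul_const 1)).add
        (hr2 y h1)).hasDerivWithinAt
    · obtain ⟨h1, h2, h3, h4⟩ := hpos y (interior_subset hy)
      have hy' : 5 / 4 * v ≤ y := interior_subset hy
      have e1 : logStepDeriv2 0 y + q * (2 / y ^ 3 - 2 / (y + 1) ^ 3) =
          (2 * q * (3 * y ^ 2 + 3 * y + 1) - y ^ 2 * (y + 1)) / (y ^ 3 * (y + 1) ^ 3) := by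
        have : y + 1 ≠ 0 := by positivity
        rw [logStepDeriv2, add_zero]
        field_simp
        ring
      suffices h : logStepDeriv2 0 y + q * (2 / y ^ 3 - 2 / (y + 1) ^ 3) ≤
          logStepDeriv2 (2 * v + 1 / 6) (y - (2 * v - 1) / 3) by linarith
      rw [e1, logStepDeriv2, div_le_div_iff₀ (by positivity) (by positivity), ← sub_nonneg]
      obtain ⟨s, rfl⟩ : ∃ s, v = 1 + s := ⟨v - 1, by ring⟩
      obtain ⟨t, rfl⟩ : ∃ t, y = 5 / 4 * (1 + s) + t := ⟨y - 5 / 4 * (1 + s), by ring⟩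
      have hs : 0 ≤ s := by linarith
      have ht : 0 ≤ t := by linarith
      rw [hq]
      clear e1 h1 h2 h3 h4 hy' hy hv hm hpos hshift hr1 hr2 hq q
      -- After subtraction of this sum of squares, all coefficients are nonnegative.
      have hsq : 0 ≤ t ^ 6 * (s ^ 2 - t) ^ 2 + 11 * (t ^ 6 * (s ^ 2 - 1) ^ 2) := by positivity
      refine hsq.trans ?_
      rw [← sub_nonneg]
      ring_nf
      positivity
  refine nonpos_of_concaveOn_of_tendsto_zero (x := m) hconc ?_ hm
  have h0 : Tendsto (fun w : ℝ => 1 / w) atTop (𝓝 0) := tendsto_const_nhds.div_atTop tendsto_id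
  have h1 : Tendsto (fun w : ℝ => 1 / (w + 1)) atTop (𝓝 0) :=
    tendsto_const_nhds.div_atTop (tendsto_atTop_add_const_right _ _ tendsto_id)
  have := ((tendsto_logStep 0).sub ((tendsto_logStep (2 * v + 1 / 6)).comp
    (tendsto_atTop_add_const_right _ (-((2 * v - 1) / 3)) tendsto_id))).add
    ((h0.sub h1).const_mul q)
  simpa [sub_eq_add_neg, Function.comp_def] using this

/-! ### A maximal inequality for empirical processes -/

/-- The function that equals `0` outside `J` and the successor of `g` on `J`.  Every placement of
points in `M + 1` cells arises in this way from the set `J` of points outside the first cell. -/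
def glue {ι : Type*} [DecidableEq ι] {M : ℕ} (J : Finset ι) (g : J → Fin M) (i : ι) :
    Fin (M + 1) :=
  if h : i ∈ J then (g ⟨i, h⟩).succ else 0

lemma glue_bijective {ι : Type*} [Fintype ι] [DecidableEq ι] {M : ℕ} :
    Function.Bijective fun x : (Σ J : Finset ι, (J → Fin M)) => glue x.1 x.2 := by
  have hmem (J : Finset ι) (g : J → Fin M) (i : ι) : i ∈ J ↔ glue J g i ≠ 0 := by
    by_cases h : i ∈ J <;> simp [glue, h, Fin.succ_ne_zero]
  constructor
  · rintro ⟨J, g⟩ ⟨J', g'⟩ h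
    simp only at h
    have hJ : J = J' := by
      ext i
      rw [hmem J g, hmem J' g', h]
    subst hJ
    congr 1
    ext ⟨i, hi⟩
    have := congrFun h i
    simp only [glue, hi, dif_pos] at this
    rw [Fin.succ_injective _ this]
  · intro f
    refine ⟨⟨univ.filter fun i => f i ≠ 0, fun i => (f i).pred (Finset.mem_filter.1 i.2).2⟩, ?_⟩
    ext i
    by_cases h : f i = 0 <;> simp [glue, h]

lemma sum_fun_fin_succ {ι : Type*} [Fintype ι] [DecidableEq ι] {M : ℕ}
    (Φ : (ι → Fin (M + 1)) → ℝ) :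
    ∑ f, Φ f = ∑ J : Finset ι, ∑ g : J → Fin M, Φ (glue J g) := by
  rw [← Fintype.sum_sigma' (f := fun (J : Finset ι) (g : J → Fin M) => Φ (glue J g))]
  exact (Fintype.sum_bijective _ glue_bijective _ _ fun _ => rfl).symm

lemma prod_glue {ι : Type*} [Fintype ι] [DecidableEq ι] {M : ℕ} (w : Fin (M + 1) → ℝ)
    (J : Finset ι) (g : J → Fin M) :
    ∏ i, w (glue J g i) = w 0 ^ (Fintype.card ι - J.card) * ∏ i, w (g i).succ := by
  rw [← Finset.prod_mul_prod_compl J, mul_comm]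
  congr 1
  · rw [← Finset.card_compl, ← Finset.prod_const]
    refine Finset.prod_congr rfl fun i hi => ?_
    simp [glue, Finset.mem_compl.1 hi]
  · rw [← Finset.prod_coe_sort]
    refine Finset.prod_congr rfl fun i _ => ?_
    simp [glue]

lemma card_glue_zero {ι : Type*} [Fintype ι] [DecidableEq ι] {M : ℕ} (J : Finset ι)
    (g : J → Fin M) : #{i | 0 < glue J g i} = #J := by
  congr 1
  ext i
  simp only [Finset.mem_filter, Finset.mem_univ, true_and]
  by_cases h : i ∈ J <;> simp [glue, h]

lemma card_glue_succ {ι : Type*} [Fintype ι] [DecidableEq ι] {M : ℕ} (J : Finset ι)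
    (g : J → Fin M) (c : Fin M) : #{i | c.succ < glue J g i} = #{i | c < g i} := by
  symm
  refine Finset.card_bij (fun i _ => (i : ι)) ?_ ?_ ?_
  · rintro ⟨i, hi⟩ h
    simp only [Finset.mem_filter, Finset.mem_univ, true_and] at h ⊢
    simpa [glue, hi] using h
  · rintro a _ b _ h
    exact Subtype.ext h
  · intro i h
    simp only [Finset.mem_filter, Finset.mem_univ, true_and] at h
    by_cases hi : i ∈ J
    · exact ⟨⟨i, hi⟩, by simpa [glue, hi] using h, rfl⟩
    · simp [glue, hi] at h

open scoped Classical in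
/-- Maximal inequality for the crossing of a boundary by an empirical process.  The points of `ι`
are thrown independently into the cells of `Fin M` with (unnormalized) weights `w`; the process is
revealed cell by cell, and `H z R` is a superharmonic functional of the remaining weight `z` and
the number `R` of remaining points.  The event `B c R` is that the boundary is crossed when `R`
points remain after cell `c`; there `H` is at least `L` times the total weight `z ^ R` of all
continuations. -/
lemma crossing_weight_le {H : ℝ → ℕ → ℝ} (hH0 : ∀ z R, 0 ≤ H z R)
    (hHs : ∀ a z R, 0 ≤ a → 0 ≤ z →
      ∑ j ∈ range (R + 1), (R.choose j : ℝ) * (a ^ (R - j) * H z j) ≤ H (a + z) R)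
    {L : ℝ} (hL : 0 ≤ L) :
    ∀ (M : ℕ) (w : Fin M → ℝ), (∀ c, 0 ≤ w c) → ∀ B : Fin M → ℕ → Prop,
      (∀ c R, B c R → L * (∑ c' with c < c', w c') ^ R ≤ H (∑ c' with c < c', w c') R) →
      ∀ (ι : Type) [Fintype ι] [DecidableEq ι],
        L * ∑ f : ι → Fin M, (∏ i, w (f i)) * (if ∃ c, B c #{i | c < f i} then 1 else 0) ≤
          H (∑ c, w c) (Fintype.card ι) := by
  intro M
  induction M with
  | zero =>
    intro w _ B _ ι _ _
    simpa using hH0 _ _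
  | succ M ih =>
    intro w hw B hB ι _ _
    have hz (c : Fin M) : ∑ c' with c.succ < c', w c' = ∑ c' with c < c', w c'.succ := by
      rw [Finset.sum_filter, Finset.sum_filter, Fin.sum_univ_succ]
      simp
    have hz0 : ∑ c' with (0 : Fin (M + 1)) < c', w c' = ∑ c', w (Fin.succ c') := by
      rw [Finset.sum_filter, Fin.sum_univ_succ]
      simp
    set z : ℝ := ∑ c', w (Fin.succ c') with hzdef
    have hz_nonneg : 0 ≤ z := Finset.sum_nonneg fun c _ => hw _
    have key (J : Finset ι) : L * ∑ g : J → Fin M, (∏ i, w (glue J g i)) *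
          (if ∃ c, B c #{i | c < glue J g i} then 1 else 0) ≤
        w 0 ^ (Fintype.card ι - J.card) * H z J.card := by
      have e : ∑ g : J → Fin M, (∏ i, w (glue J g i)) *
          (if ∃ c, B c #{i | c < glue J g i} then 1 else 0) =
          w 0 ^ (Fintype.card ι - J.card) * ∑ g : J → Fin M, (∏ i, w (g i).succ) *
          (if ∃ c, B c #{i | c < glue J g i} then 1 else 0) := by
        rw [Finset.mul_sum]
        exact Finset.sum_congr rfl fun g _ => by rw [prod_glue, mul_assoc]
      rw [e, mul_left_comm]
      refine mul_le_mul_of_nonneg_left ?_ (pow_nonneg (hw 0) _)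
      by_cases h0 : B 0 J.card
      · have h1 := hB 0 _ h0
        rw [hz0] at h1
        refine le_trans (mul_le_mul_of_nonneg_left ?_ hL) h1
        have h2 : z ^ J.card = ∑ g : J → Fin M, ∏ i, w (g i).succ := by
          have := Finset.prod_univ_sum (fun _ : J => (univ : Finset (Fin M)))
            fun _ c => w (Fin.succ c)
          rw [Fintype.piFinset_univ] at this
          rw [← this, Finset.prod_const, Finset.card_univ, Fintype.card_coe]
        rw [h2]
        refine Finset.sum_le_sum fun g _ => mul_le_of_le_one_right
          (Finset.prod_nonneg fun i _ => hw _) ?_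
        split_ifs <;> norm_num
      · have h1 := ih (fun c => w c.succ) (fun c => hw _) (fun c R => B c.succ R)
          (fun c R h => by simpa only [hz] using hB _ _ h) J
        rw [Fintype.card_coe] at h1
        refine le_of_eq_of_le ?_ h1
        congr 1
        refine Finset.sum_congr rfl fun g _ => ?_
        congr 1
        simp only [Fin.exists_fin_succ, card_glue_zero, card_glue_succ, h0, false_or]
    rw [sum_fun_fin_succ, Finset.mul_sum]
    refine (Finset.sum_le_sum fun J _ => key J).trans ?_
    rw [Fin.sum_univ_succ]
    refine le_of_eq_of_le ?_ (hHs (w 0) z (Fintype.card ι) (hw 0) hz_nonneg)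
    rw [← Finset.powerset_univ, Finset.sum_powerset_apply_card
      (fun j => w 0 ^ (Fintype.card ι - j) * H z j), Finset.card_univ]
    simp [nsmul_eq_mul]

/-! ### Boundary crossing for independent and identically distributed points -/

/-- The rising product `y (y + 1) ⋯ (y + R)`, with `R + 1` factors. -/
noncomputable def risingProd (y : ℝ) (R : ℕ) : ℝ := ∏ j ∈ range (R + 1), (y + j)

lemma risingProd_pos {y : ℝ} (hy : 0 < y) (R : ℕ) : 0 < risingProd y R :=
  Finset.prod_pos fun j _ => by positivity

lemma risingProd_succ (y : ℝ) (R : ℕ) :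
    risingProd y (R + 1) = risingProd y R * (y + (R + 1 : ℕ)) := by
  rw [risingProd, Finset.prod_range_succ, ← risingProd]

/-- The functional `b ^ (R + y) R! / (y (y + 1) ⋯ (y + R))`.  It is the Beta integral
`∫₀ᵇ s ^ (y - 1) (b - s) ^ R ds`, that is, a mixture of the harmonic functionals `(b - s) ^ R`. -/
noncomputable def betaFun (y : ℝ) (R : ℕ) (b : ℝ) : ℝ :=
  b ^ ((R : ℝ) + y) * (R.factorial / risingProd y R)

lemma betaFun_nonneg {y b : ℝ} (hy : 0 < y) (hb : 0 ≤ b) (R : ℕ) : 0 ≤ betaFun y R b := by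
  have := risingProd_pos hy R
  unfold betaFun
  positivity

lemma hasDerivAt_betaFun_succ {y : ℝ} (hy : 0 < y) (R : ℕ) (b : ℝ) :
    HasDerivAt (betaFun y (R + 1)) ((R + 1) * betaFun y R b) b := by
  have h1 : HasDerivAt (fun b : ℝ => b ^ (((R + 1 : ℕ) : ℝ) + y))
      ((((R + 1 : ℕ) : ℝ) + y) * b ^ ((((R + 1 : ℕ) : ℝ) + y) - 1)) b :=
    Real.hasDerivAt_rpow_const (Or.inr (by push_cast; linarith [Nat.cast_nonneg (α := ℝ) R]))
  refine (h1.mul_const _).congr_deriv ?_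
  have h2 := (risingProd_pos hy R).ne'
  have h3 : y + ((R + 1 : ℕ) : ℝ) ≠ 0 := by positivity
  have h4 : (((R + 1 : ℕ) : ℝ) + y) - 1 = (R : ℝ) + y := by push_cast; ring
  rw [h4, risingProd_succ, Nat.factorial_succ, betaFun]
  push_cast at h3 ⊢
  field_simp
  ring

/-- The superharmonicity of `betaFun`.  Both sides agree at `a = 0`, and their derivatives in `a`
are `R` times the two sides for `R - 1`. -/
lemma sum_choose_betaFun_le {y b : ℝ} (hy : 0 < y) (hb : 0 ≤ b) (R : ℕ) :
    ∀ a : ℝ, 0 ≤ a →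
      ∑ j ∈ range (R + 1), (R.choose j : ℝ) * (a ^ (R - j) * betaFun y j b) ≤
        betaFun y R (a + b) := by
  induction R with
  | zero =>
    intro a ha
    simp only [zero_add, range_one, sum_singleton, Nat.choose_self, Nat.cast_one, one_mul,
      Nat.sub_self, pow_zero, betaFun, Nat.cast_zero]
    have := risingProd_pos hy 0
    gcongr
    linarith
  | succ R ih =>
    intro a ha
    have hd (a : ℝ) : HasDerivAt (fun a : ℝ => betaFun y (R + 1) (a + b) -
        ∑ j ∈ range (R + 1 + 1), ((R + 1).choose j : ℝ) * (a ^ (R + 1 - j) * betaFun y j b))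
        ((R + 1) * betaFun y R (a + b) - (R + 1) * ∑ j ∈ range (R + 1),
          (R.choose j : ℝ) * (a ^ (R - j) * betaFun y j b)) a := by
      refine HasDerivAt.sub ?_ ?_
      · exact (hasDerivAt_betaFun_succ hy R (a + b)).comp_add_const a b
      · have h1 : HasDerivAt (fun a : ℝ => ∑ j ∈ range (R + 1 + 1),
            ((R + 1).choose j : ℝ) * (a ^ (R + 1 - j) * betaFun y j b))
            (∑ j ∈ range (R + 1 + 1), ((R + 1).choose j : ℝ) *
              (((R + 1 - j : ℕ) : ℝ) * a ^ (R + 1 - j - 1) * betaFun y j b)) a :=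
          HasDerivAt.fun_sum fun j _ =>
            ((hasDerivAt_pow (R + 1 - j) a).mul_const _).const_mul _
        refine h1.congr_deriv ?_
        rw [Finset.sum_range_succ, Nat.sub_self, Nat.cast_zero, zero_mul, zero_mul, mul_zero,
          add_zero, Finset.mul_sum]
        refine Finset.sum_congr rfl fun j _ => ?_
        have h2 : ((R.choose j : ℕ) : ℝ) * (R + 1) =
            (R + 1).choose j * ((R + 1 - j : ℕ) : ℝ) := by
          exact_mod_cast Nat.choose_mul_succ_eq R j
        have h3 : R + 1 - j - 1 = R - j := by omega
        rw [h3]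
        linear_combination (-(a ^ (R - j) * betaFun y j b)) * h2
    have hmono := monotoneOn_of_hasDerivWithinAt_nonneg (convex_Ici (0 : ℝ))
      (fun a _ => (hd a).continuousAt.continuousWithinAt)
      (fun a _ => (hd a).hasDerivWithinAt) (fun a ha => by
        have ha : (0 : ℝ) ≤ a := interior_subset ha
        rw [← mul_sub]
        exact mul_nonneg (by positivity) (sub_nonneg.2 (ih a ha)))
    have h0 := hmono (Set.mem_Ici.2 le_rfl) (Set.mem_Ici.2 ha) ha
    have h1 : ∑ j ∈ range (R + 1 + 1),
        ((R + 1).choose j : ℝ) * ((0 : ℝ) ^ (R + 1 - j) * betaFun y j b) =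
        betaFun y (R + 1) b := by
      rw [Finset.sum_range_succ, Finset.sum_eq_zero]
      · simp
      · intro j hj
        rw [zero_pow (by have := Finset.mem_range.1 hj; omega)]
        simp
    simp only [zero_add] at h0
    rw [h1, sub_self] at h0
    linarith

open scoped Classical in
/-- Upper bound for the probability that `n` independent, identically distributed points cross a
boundary, in terms of a superharmonic functional. -/
lemma crossing_prob_le {H : ℝ → ℕ → ℝ} (hH0 : ∀ z R, 0 ≤ H z R)
    (hHs : ∀ a z R, 0 ≤ a → 0 ≤ z →
      ∑ j ∈ range (R + 1), (R.choose j : ℝ) * (a ^ (R - j) * H z j) ≤ H (a + z) R)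
    {L : ℝ} (hL : 0 < L) {M n : ℕ} (hn : 0 < n) {q : Fin M → ℝ} (hq0 : ∀ c, 0 ≤ q c)
    (hq1 : ∑ c, q c = 1) {B : Fin M → ℕ → Prop}
    (hB : ∀ c R, B c R → L * (n * ∑ c' with c < c', q c') ^ R ≤
      H (n * ∑ c' with c < c', q c') R) :
    ∑ f : Fin n → Fin M, (∏ i, q (f i)) * (if ∃ c, B c #{i | c < f i} then 1 else 0) ≤
      H n n / (L * (n : ℝ) ^ n) := by
  have h := crossing_weight_le hH0 hHs hL.le M (fun c => n * q c)
    (fun c => mul_nonneg (Nat.cast_nonneg n) (hq0 c)) B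
    (fun c R hc => by simpa only [← Finset.mul_sum] using hB c R hc) (Fin n)
  rw [← Finset.mul_sum, hq1, mul_one, Fintype.card_fin] at h
  have hnR : (0 : ℝ) < n := Nat.cast_pos.2 hn
  rw [le_div_iff₀ (by positivity)]
  refine le_of_eq_of_le ?_ h
  rw [mul_comm, mul_assoc, Finset.mul_sum]
  congr 1
  refine Finset.sum_congr rfl fun f _ => ?_
  rw [Finset.prod_mul_distrib, Finset.prod_const, Finset.card_univ, Fintype.card_fin, mul_assoc]

/-- The logarithm of the normalized functional `betaFun y R (z - κ) / z ^ R`. -/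
noncomputable def logBeta (κ y z : ℝ) (R : ℕ) : ℝ :=
  (R + y) * Real.log (z - κ) - R * Real.log z + Real.log R.factorial - Real.log (risingProd y R)

lemma betaFun_eq_exp_logBeta {κ y z : ℝ} (hy : 0 < y) (hz : 0 < z) (hzκ : κ < z) (R : ℕ) :
    betaFun y R (z - κ) = Real.exp (logBeta κ y z R) * z ^ R := by
  have h1 := risingProd_pos hy R
  have h2 : (0 : ℝ) < R.factorial := by positivity
  have h3 : 0 < z - κ := sub_pos.2 hzκ
  rw [logBeta, Real.exp_sub, Real.exp_add, Real.exp_sub, Real.exp_log h1, Real.exp_log h2,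
    betaFun, Real.rpow_def_of_pos h3, ← Real.log_pow, Real.exp_log (by positivity),
    mul_comm (Real.log (z - κ))]
  field_simp

lemma logBeta_mono {κ y z z' : ℝ} (hκ : 0 ≤ κ) (hy : 0 < y) (hz : κ < z) (hzz : z ≤ z') (R : ℕ) :
    logBeta κ y z R ≤ logBeta κ y z' R := by
  have h0 : 0 < z := hκ.trans_lt hz
  have h1 : Real.log (z - κ) ≤ Real.log (z' - κ) :=
    Real.log_le_log (by linarith) (by linarith)
  have h2 : Real.log (z - κ) - Real.log z ≤ Real.log (z' - κ) - Real.log z' := by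
    rw [← Real.log_div (by linarith) (by linarith), ← Real.log_div (by linarith) (by linarith)]
    refine Real.log_le_log (div_pos (by linarith) h0) ?_
    rw [div_le_div_iff₀ h0 (by linarith)]
    nlinarith
  have h3 := mul_le_mul_of_nonneg_left h2 (Nat.cast_nonneg (α := ℝ) R)
  have h4 := mul_le_mul_of_nonneg_left h1 hy.le
  unfold logBeta
  linarith

lemma logBeta_succ_sub {κ y z : ℝ} (hy : 0 < y) (R : ℕ) :
    logBeta κ y (z + 1) (R + 1) - logBeta κ y z R =
      logStep (R + 1 + y - (z - κ)) (z - κ) - logStep (R + 1 - z) z := by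
  have h1 := risingProd_pos hy R
  have h2 : (0 : ℝ) < R.factorial := by positivity
  have h3 : (0 : ℝ) < y + (R + 1 : ℕ) := by positivity
  simp only [logBeta, logStep, risingProd_succ, Nat.factorial_succ]
  rw [Real.log_mul h1.ne' h3.ne', Nat.cast_mul, Real.log_mul (by positivity) h2.ne']
  have e1 : z + 1 - κ = z - κ + 1 := by ring
  have e2 : y + ((R + 1 : ℕ) : ℝ) = z - κ + (R + 1 + y - (z - κ)) := by push_cast; ring
  have e3 : ((R + 1 : ℕ) : ℝ) = z + (R + 1 - z) := by push_cast; ring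
  rw [e1, e2, e3]
  ring

/-- For the parameters `κ = (2 v - 1) / 3` and `y = 4 v / 3 - 1 / 2` the functional is, at every
crossing, at least its value at time zero times `exp ((2 v² - 1.19 v) / n)`. -/
lemma logBeta_crossing {v : ℝ} (hv : 1 ≤ v) {n : ℕ} (hn : 5 / 4 * v ≤ n) {R : ℕ} {z : ℝ}
    (hz : R + v ≤ z) :
    logBeta ((2 * v - 1) / 3) (4 / 3 * v - 1 / 2) n n + (2 * v ^ 2 - 119 / 100 * v) / n ≤
      logBeta ((2 * v - 1) / 3) (4 / 3 * v - 1 / 2) z R := by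
  have hκ : 0 ≤ (2 * v - 1) / 3 := by linarith
  have hy : 0 < 4 / 3 * v - 1 / 2 := by linarith
  set κ : ℝ := (2 * v - 1) / 3 with hκ_def
  set y : ℝ := 4 / 3 * v - 1 / 2 with hy_def
  set q : ℝ := 2 * v ^ 2 - 119 / 100 * v with hq
  have hb : Antitone fun m : ℕ => logBeta κ y (m + v) m := by
    refine antitone_nat_of_succ_le fun m => ?_
    have h1 := logBeta_succ_sub (κ := κ) (z := m + v) hy m
    have h2 := logStep_boundary_le hv (z := m + v) (by linarith [Nat.cast_nonneg (α := ℝ) m])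
    have e1 : (m : ℝ) + 1 + y - (m + v - κ) = v + 1 / 6 := by rw [hκ_def, hy_def]; ring
    have e2 : (m : ℝ) + 1 - (m + v) = 1 - v := by ring
    rw [e1, e2] at h1
    have e3 : ((m + 1 : ℕ) : ℝ) + v = m + v + 1 := by push_cast; ring
    simp only [e3]
    linarith
  have hd (m : ℕ) (hm : n ≤ m) : logBeta κ y n n + q / n ≤ logBeta κ y m m + q / m := by
    induction m, hm using Nat.le_induction with
    | base => exact le_rfl
    | succ m hm ih =>
      have h1 := logBeta_succ_sub (κ := κ) (z := m) hy m
      have hmn : (n : ℝ) ≤ m := Nat.cast_le.2 hm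
      have h2 := logStep_diagonal_le hv (m := m) (hn.trans hmn)
      have e1 : (m : ℝ) + 1 + y - (m - κ) = 2 * v + 1 / 6 := by rw [hκ_def, hy_def]; ring
      have e2 : (m : ℝ) + 1 - m = 1 := by ring
      have e3 : logStep 1 (m : ℝ) = logStep 0 m := by simp only [logStep]; ring_nf
      rw [e1, e2, e3] at h1
      push_cast
      linarith
  -- Go along the boundary from `R` to a large `m`, across to the diagonal, and back to `n`; the
  -- loss `q / m` disappears as `m` tends to infinity.
  have hlim : Tendsto (fun m : ℕ => logBeta κ y n n + q / n - q / m) atTop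
      (𝓝 (logBeta κ y n n + q / n - 0)) :=
    tendsto_const_nhds.sub (tendsto_const_div_atTop_nhds_zero_nat q)
  rw [sub_zero] at hlim
  refine le_of_tendsto hlim ?_
  filter_upwards [eventually_ge_atTop n, eventually_ge_atTop R] with m hm hR
  have h1 := hd m hm
  have hmn : (n : ℝ) ≤ m := Nat.cast_le.2 hm
  have hR0 : (0 : ℝ) ≤ R := Nat.cast_nonneg R
  have h2 : logBeta κ y m m ≤ logBeta κ y (m + v) m :=
    logBeta_mono hκ hy (by rw [hκ_def]; linarith) (by linarith) m
  have h3 : logBeta κ y (m + v) m ≤ logBeta κ y (R + v) R := hb hR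
  have h4 := logBeta_mono hκ hy (by rw [hκ_def]; linarith) hz R
  linarith

open scoped Classical in
/-- Boundary crossing probability of an empirical process, away from the extreme regime. -/
lemma iid_crossing_le {v : ℝ} (hv : 1 ≤ v) {M n : ℕ} (hn : 5 / 4 * v ≤ n) {q : Fin M → ℝ}
    (hq0 : ∀ c, 0 ≤ q c) (hq1 : ∑ c, q c = 1) {B : Fin M → ℕ → Prop}
    (hB : ∀ c R, B c R → R + v ≤ n * ∑ c' with c < c', q c') :
    ∑ f : Fin n → Fin M, (∏ i, q (f i)) * (if ∃ c, B c #{i | c < f i} then 1 else 0) ≤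
      Real.exp (-((2 * v ^ 2 - 119 / 100 * v) / n)) := by
  set κ : ℝ := (2 * v - 1) / 3 with hκ_def
  set y : ℝ := 4 / 3 * v - 1 / 2 with hy_def
  have hκ : 0 ≤ κ := by rw [hκ_def]; linarith
  have hy : 0 < y := by rw [hy_def]; linarith
  have hκv : κ < v := by rw [hκ_def]; linarith
  have hnR : (0 : ℝ) < n := by linarith
  set L : ℝ := Real.exp (logBeta κ y n n + (2 * v ^ 2 - 119 / 100 * v) / n) with hL
  have h := crossing_prob_le (H := fun z R => betaFun y R (max (z - κ) 0))
    (fun z R => betaFun_nonneg hy (le_max_right _ _) R) (fun a z R ha hz => ?_)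
    (L := L) (Real.exp_pos _) (Nat.cast_pos.1 hnR) hq0 hq1 (B := B) (fun c R hc => ?_)
  · refine h.trans_eq ?_
    have hκn : κ < n := by linarith
    rw [max_eq_left (by linarith), betaFun_eq_exp_logBeta hy hnR hκn, mul_div_mul_right _ _
      (by positivity), hL, ← Real.exp_sub]
    congr 1
    ring
  · rcases le_total κ z with hκz | hκz
    · have h1 := sum_choose_betaFun_le hy (sub_nonneg.2 hκz) R a ha
      simp only [max_eq_left (sub_nonneg.2 hκz), max_eq_left (show 0 ≤ a + z - κ by linarith)]
      rwa [show a + z - κ = a + (z - κ) by ring]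
    · have h1 (j : ℕ) : betaFun y j 0 = 0 := by
        rw [betaFun, Real.zero_rpow (by positivity), zero_mul]
      simp only [max_eq_right (sub_nonpos.2 hκz), h1, mul_zero, Finset.sum_const_zero]
      exact betaFun_nonneg hy (le_max_right _ _) R
  · have h1 := hB c R hc
    have hR0 : (0 : ℝ) ≤ R := Nat.cast_nonneg R
    have h2 : κ < n * ∑ c' with c < c', q c' := by linarith
    rw [max_eq_left (by linarith), betaFun_eq_exp_logBeta hy (by linarith) h2]
    refine mul_le_mul_of_nonneg_right ?_ (pow_nonneg (by linarith) R)
    exact Real.exp_le_exp.2 (logBeta_crossing hv hn h1)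

/-- The functional `(z - v) ^ R` is harmonic, and at a crossing it is at least `L z ^ R` with
`L = (1 - v / n) ^ (n - v)`. -/
lemma rpow_mul_pow_le {v : ℝ} (hv : 0 < v) {n : ℕ} (hvn : v < n) {R : ℕ} {z : ℝ}
    (hz : R + v ≤ z) (hzn : z ≤ n) : (1 - v / n) ^ ((n : ℝ) - v) * z ^ R ≤ (z - v) ^ R := by
  have hR0 : (0 : ℝ) ≤ R := Nat.cast_nonneg R
  have hn0 : (0 : ℝ) < n := hv.trans hvn
  have hz0 : 0 < z := by linarith
  have hbase : 0 < 1 - v / n := by rw [sub_pos, div_lt_one hn0]; exact hvn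
  rcases Nat.eq_zero_or_pos R with rfl | hR
  · simp only [pow_zero, mul_one]
    refine Real.rpow_le_one hbase.le ?_ (by linarith)
    have : 0 ≤ v / n := by positivity
    linarith
  have hR1 : (0 : ℝ) < R := Nat.cast_pos.2 hR
  have hnv : 0 < (n : ℝ) - v := by linarith
  -- `(1 + v / s) ^ s` is nondecreasing in `s`; compare `s = R` with `s = n - v`.
  have h1 : 1 + v / R ≤ (1 + v / ((n : ℝ) - v)) ^ (((n : ℝ) - v) / R) := by
    have := one_add_mul_self_le_rpow_one_add (s := v / ((n : ℝ) - v)) (p := ((n : ℝ) - v) / R)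
      (by have : 0 ≤ v / ((n : ℝ) - v) := by positivity
          linarith) ((one_le_div hR1).2 (by linarith))
    refine le_trans (le_of_eq ?_) this
    field_simp
  have h2 : 1 + v / ((n : ℝ) - v) = (1 - v / n)⁻¹ := by field_simp; ring
  have h3 : (1 + v / R) ^ R ≤ (1 - v / n) ^ (-((n : ℝ) - v)) := by
    refine (pow_le_pow_left₀ (by positivity) h1 R).trans_eq ?_
    rw [h2, ← Real.rpow_natCast, ← Real.rpow_mul (by positivity), Real.inv_rpow hbase.le,
      ← Real.rpow_neg hbase.le, div_mul_cancel₀ _ hR1.ne']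
  have h4 : z ≤ (z - v) * (1 + v / R) := by
    have : (z - v) * (1 + v / R) - z = v * (z - (R + v)) / R := by field_simp; ring
    have : 0 ≤ v * (z - (R + v)) / R :=
      div_nonneg (mul_nonneg hv.le (by linarith)) hR1.le
    linarith
  have h5 : z ^ R ≤ (z - v) ^ R * (1 - v / n) ^ (-((n : ℝ) - v)) := by
    refine (pow_le_pow_left₀ hz0.le h4 R).trans ?_
    rw [mul_pow]
    exact mul_le_mul_of_nonneg_left h3 (pow_nonneg (by linarith) R)
  calc (1 - v / n) ^ ((n : ℝ) - v) * z ^ R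
      ≤ (1 - v / n) ^ ((n : ℝ) - v) * ((z - v) ^ R * (1 - v / n) ^ (-((n : ℝ) - v))) :=
        mul_le_mul_of_nonneg_left h5 (Real.rpow_nonneg hbase.le _)
    _ = (z - v) ^ R * ((1 - v / n) ^ ((n : ℝ) - v) * (1 - v / n) ^ (-((n : ℝ) - v))) := by ring
    _ = (z - v) ^ R := by
        rw [← Real.rpow_add hbase, add_neg_cancel, Real.rpow_zero, mul_one]

open scoped Classical in
/-- A cruder bound for boundary crossing probabilities, which is sharp enough when `v` is close
to `n`. -/
lemma iid_crossing_le_rpow {v : ℝ} (hv : 0 < v) {M n : ℕ} (hvn : v < n) {q : Fin M → ℝ}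
    (hq0 : ∀ c, 0 ≤ q c) (hq1 : ∑ c, q c = 1) {B : Fin M → ℕ → Prop}
    (hB : ∀ c R, B c R → R + v ≤ n * ∑ c' with c < c', q c') :
    ∑ f : Fin n → Fin M, (∏ i, q (f i)) * (if ∃ c, B c #{i | c < f i} then 1 else 0) ≤
      (1 - v / n) ^ v := by
  have hnR : (0 : ℝ) < n := hv.trans hvn
  have hbase : 0 < 1 - v / n := by rw [sub_pos, div_lt_one hnR]; exact hvn
  have h := crossing_prob_le (H := fun z R => if v ≤ z then (z - v) ^ R else 0)
    (fun z R => ?_) (fun a z R ha hz => ?_)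
    (L := (1 - v / n) ^ ((n : ℝ) - v)) (Real.rpow_pos_of_pos hbase _) (Nat.cast_pos.1 hnR)
    hq0 hq1 (B := B) (fun c R hc => ?_)
  · refine h.trans_eq ?_
    rw [if_pos hvn.le, mul_comm, ← div_div, ← div_pow, show ((n : ℝ) - v) / n = 1 - v / n by
      field_simp, ← Real.rpow_natCast, ← Real.rpow_sub hbase]
    congr 1
    ring
  · split_ifs with h
    · exact pow_nonneg (sub_nonneg.2 h) R
    · exact le_rfl
  · split_ifs with h1 h2 h2
    · rw [show a + z - v = a + (z - v) by ring, add_comm a (z - v), add_pow]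
      exact le_of_eq (Finset.sum_congr rfl fun j _ => by ring)
    · linarith
    · simp only [mul_zero, Finset.sum_const_zero]
      exact pow_nonneg (sub_nonneg.2 h2) R
    · simp
  · have h1 := hB c R hc
    have hR0 : (0 : ℝ) ≤ R := Nat.cast_nonneg R
    rw [if_pos (by linarith)]
    refine rpow_mul_pow_le hv hvn h1 (mul_le_of_le_one_right hnR.le ?_)
    rw [← hq1]
    exact Finset.sum_le_sum_of_subset_of_nonneg (Finset.filter_subset _ _) fun c _ _ => hq0 c

/-! ### Summation over the crossing levels -/

lemma one_sub_le_exp_neg_two_mul {r : ℝ} (hr : 4 / 5 ≤ r) : 1 - r ≤ Real.exp (-(2 * r)) := by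
  have h1 : (1 / 5 : ℝ) ≤ Real.exp (-(8 / 5)) := by
    have h2 : Real.exp (8 / 5) ^ 5 = Real.exp 1 ^ 8 := by
      rw [← Real.exp_nat_mul, ← Real.exp_nat_mul]; norm_num
    have h3 : Real.exp 1 ^ 8 ≤ 5 ^ 5 := by
      have := Real.exp_one_lt_d9.le
      calc Real.exp 1 ^ 8 ≤ 2.7182818286 ^ 8 := by gcongr
        _ ≤ 5 ^ 5 := by norm_num
    have h4 : Real.exp (8 / 5) ≤ 5 :=
      le_of_pow_le_pow_left₀ (n := 5) (by norm_num) (by norm_num) (h2 ▸ h3)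
    rw [Real.exp_neg, one_div]
    gcongr
  have h5 : Real.exp (-(2 * r)) = Real.exp (-(8 / 5)) * Real.exp (-(2 * (r - 4 / 5))) := by
    rw [← Real.exp_add]; ring_nf
  have h6 := Real.add_one_le_exp (-(2 * (r - 4 / 5)))
  have h7 : 1 / 5 * Real.exp (-(2 * (r - 4 / 5))) ≤ Real.exp (-(2 * r)) := by
    rw [h5]; gcongr
  linarith

lemma log_add_half_le_log_exp_sub_one {θ : ℝ} (hθ : 0 < θ) :
    Real.log θ + θ / 2 ≤ Real.log (Real.exp θ - 1) := by
  have h1 : θ * Real.exp (θ / 2) ≤ Real.exp θ - 1 := by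
    have h2 := Real.self_le_sinh_iff.2 (by positivity : 0 ≤ θ / 2)
    rw [Real.sinh_eq] at h2
    have h3 : Real.exp θ = Real.exp (θ / 2) * Real.exp (θ / 2) := by
      rw [← Real.exp_add]; ring_nf
    have h4 : Real.exp (θ / 2) * Real.exp (-(θ / 2)) = 1 := by
      rw [← Real.exp_add, add_neg_cancel, Real.exp_zero]
    nlinarith [Real.exp_pos (θ / 2)]
  calc Real.log θ + θ / 2 = Real.log (θ * Real.exp (θ / 2)) := by
        rw [Real.log_mul hθ.ne' (Real.exp_ne_zero _), Real.log_exp]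
    _ ≤ _ := Real.log_le_log (by positivity) h1

lemma exp_neg_add_exp_le_one {θ : ℝ} (h1 : 3 / 5 ≤ θ) (h2 : θ ≤ 16 / 5) :
    Real.exp (-θ) + Real.exp (119 / 400 * θ - 1) ≤ 1 := by
  have key (x : ℝ) (hx : 0 ≤ x) (c : ℝ) (hc : 0 < c)
      (h : c⁻¹ ≤ ∑ i ∈ range 6, x ^ i / (i.factorial : ℝ)) : Real.exp (-x) ≤ c := by
    rw [Real.exp_neg]
    exact inv_le_of_inv_le₀ hc (h.trans (Real.sum_le_exp_of_nonneg hx 6))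
  have e1 : Real.exp (-(3 / 5)) ≤ 11 / 20 :=
    key _ (by norm_num) _ (by norm_num) (by norm_num [Finset.sum_range_succ, Nat.factorial])
  have e2 : Real.exp (119 / 400 * (3 / 5) - 1) ≤ 22 / 50 := by
    rw [show (119 / 400 * (3 / 5) - 1 : ℝ) = -(1 - 119 / 400 * (3 / 5)) by ring]
    exact key _ (by norm_num) _ (by norm_num) (by norm_num [Finset.sum_range_succ, Nat.factorial])
  have e3 : Real.exp (-(16 / 5)) ≤ 42 / 1000 := by
    rw [show (-(16 / 5) : ℝ) = (4 : ℕ) * (-(4 / 5)) by norm_num, Real.exp_nat_mul]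
    have := key (4 / 5) (by norm_num) (45 / 100) (by norm_num)
      (by norm_num [Finset.sum_range_succ, Nat.factorial])
    calc Real.exp (-(4 / 5)) ^ 4 ≤ (45 / 100) ^ 4 := by gcongr
      _ ≤ 42 / 1000 := by norm_num
  have e4 : Real.exp (119 / 400 * (16 / 5) - 1) ≤ 954 / 1000 := by
    rw [show (119 / 400 * (16 / 5) - 1 : ℝ) = -(1 - 119 / 400 * (16 / 5)) by ring]
    exact key _ (by norm_num) _ (by norm_num) (by norm_num [Finset.sum_range_succ, Nat.factorial])
  -- The left side is convex, so it suffices to bound it at the end points.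
  set s : ℝ := (θ - 3 / 5) / (13 / 5) with hs
  have hs0 : 0 ≤ s := div_nonneg (by linarith) (by norm_num)
  have hs1 : 0 ≤ 1 - s := by
    rw [hs, sub_nonneg, div_le_one (by norm_num)]; linarith
  have hθ : θ = (1 - s) * (3 / 5) + s * (16 / 5) := by rw [hs]; ring
  have c1 := convexOn_exp.2 (Set.mem_univ (-(3 / 5))) (Set.mem_univ (-(16 / 5))) hs1 hs0 (by ring)
  have c2 := convexOn_exp.2 (Set.mem_univ (119 / 400 * (3 / 5) - 1))
    (Set.mem_univ (119 / 400 * (16 / 5) - 1)) hs1 hs0 (by ring)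
  simp only [smul_eq_mul] at c1 c2
  rw [show (1 - s) * -(3 / 5) + s * -(16 / 5) = -θ by rw [hθ]; ring] at c1
  rw [show (1 - s) * (119 / 400 * (3 / 5) - 1) + s * (119 / 400 * (16 / 5) - 1) =
    119 / 400 * θ - 1 by rw [hθ]; ring] at c2
  have d1 := mul_le_mul_of_nonneg_left (add_le_add e1 e2) hs1
  have d2 := mul_le_mul_of_nonneg_left (add_le_add e3 e4) hs0
  linarith

/-- The choice of the number `d` for which the indicator of `D ≥ 0` is compared with
`(D + d)⁺ / d`.  The geometric sum of the crossing bounds is optimal for `θ d` close to `1`; the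
factor `exp (1.19 θ / 4)` comes from the linear term in these bounds.  The bound `d ≤ 2 / θ` keeps
all crossing levels at least `1`. -/
lemma exists_level {θ : ℝ} (hθ : 0 < θ) (hθ' : θ ≤ 16 / 5) :
    ∃ d : ℕ, 1 ≤ d ∧ (d = 1 ∨ (d : ℝ) ≤ 2 / θ) ∧
      Real.exp (119 / 400 * θ) * Real.exp (θ * d) ≤ Real.exp 1 * d * (Real.exp θ - 1) := by
  have hexp : 0 < Real.exp θ - 1 := by
    have := Real.add_one_lt_exp hθ.ne'
    linarith
  have hlog := log_add_half_le_log_exp_sub_one hθ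
  -- The required inequality in terms of `r = θ d`.
  have key (d : ℕ) (hd : 1 ≤ d) (h : θ * d - 1 - Real.log (θ * d) ≤ 81 / 400 * θ) :
      Real.exp (119 / 400 * θ) * Real.exp (θ * d) ≤ Real.exp 1 * d * (Real.exp θ - 1) := by
    have hd0 : (0 : ℝ) < d := by exact_mod_cast hd
    rw [← Real.exp_add, ← Real.log_le_log_iff (Real.exp_pos _) (by positivity), Real.log_exp,
      Real.log_mul (by positivity) hexp.ne', Real.log_mul (by positivity) hd0.ne', Real.log_exp]
    rw [Real.log_mul hθ.ne' hd0.ne'] at h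
    linarith
  rcases le_total θ (2 / 5) with h1 | h1
  · have hle := Nat.le_ceil (1 / θ)
    have hlt := Nat.ceil_lt_add_one (by positivity : 0 ≤ 1 / θ)
    set d := ⌈1 / θ⌉₊ with hd
    have hd1 : 1 ≤ d := Nat.one_le_ceil_iff.2 (by positivity)
    have hr : 1 ≤ θ * d := by
      rw [div_le_iff₀ hθ] at hle; linarith
    have hr' : θ * d ≤ 1 + θ := by
      have := mul_le_mul_of_nonneg_left hlt.le hθ.le
      rw [mul_add, mul_one_div_cancel hθ.ne'] at this
      linarith
    refine ⟨d, hd1, Or.inr ?_, key d hd1 ?_⟩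
    · rw [le_div_iff₀ hθ]; linarith
    · set u := θ * d - 1 with hu
      have hu0 : 0 ≤ u := by linarith
      have h3 := Real.le_log_one_add_of_nonneg hu0
      rw [show 1 + u = θ * d by rw [hu]; ring] at h3
      have h4 : u - 2 * u / (u + 2) = u ^ 2 / (u + 2) := by field_simp; ring
      have h5 : u ^ 2 / (u + 2) ≤ u ^ 2 / 2 := by gcongr; linarith
      nlinarith
  rcases le_total θ (3 / 5) with h2 | h2
  · refine ⟨2, by norm_num, Or.inr ?_, key 2 (by norm_num) ?_⟩
    · rw [le_div_iff₀ hθ]; push_cast; linarith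
    · push_cast
      have h3 := Real.one_sub_inv_le_log_of_pos (by positivity : 0 < θ * 2)
      have h4 : θ * 2 - 1 - (1 - (θ * 2)⁻¹) = (θ * 2 - 1) ^ 2 / (θ * 2) := by field_simp
      have h5 : (θ * 2 - 1) ^ 2 / (θ * 2) ≤ 81 / 400 * θ := by
        rw [div_le_iff₀ (by positivity)]; nlinarith
      linarith
  · refine ⟨1, le_rfl, Or.inl rfl, ?_⟩
    have h3 := exp_neg_add_exp_le_one h2 hθ'
    have h4 : Real.exp (-θ) * Real.exp θ = 1 := by
      rw [← Real.exp_add, neg_add_cancel, Real.exp_zero]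
    have h5 : Real.exp (119 / 400 * θ - 1) * Real.exp 1 = Real.exp (119 / 400 * θ) := by
      rw [← Real.exp_add, sub_add_cancel]
    rw [Nat.cast_one, mul_one, mul_one, ← h5]
    have h6 : Real.exp (119 / 400 * θ - 1) * Real.exp θ ≤ Real.exp θ - 1 := by
      nlinarith [Real.exp_pos θ]
    nlinarith [Real.exp_pos 1]

lemma sum_exp_neg_mul_le {θ : ℝ} (hθ : 0 < θ) (N : ℕ) :
    ∑ t ∈ Icc 1 N, Real.exp (-(θ * t)) ≤ 1 / (Real.exp θ - 1) := by
  have hexp : 0 < Real.exp θ - 1 := by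
    have := Real.add_one_lt_exp hθ.ne'
    linarith
  have h1 : ∀ N : ℕ, ∑ t ∈ Icc 1 N, Real.exp (-(θ * t)) =
      (1 - Real.exp (-(θ * N))) / (Real.exp θ - 1) := by
    intro N
    induction N with
    | zero => simp
    | succ N ih =>
      rw [Finset.sum_Icc_succ_top (by omega), ih]
      have h2 : Real.exp (-(θ * N)) = Real.exp (-(θ * (N + 1 : ℕ))) * Real.exp θ := by
        rw [← Real.exp_add]; push_cast; ring_nf
      rw [h2]
      field_simp
      ring
  rw [h1]
  gcongr
  linarith [Real.exp_pos (-(θ * N))]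

/-- Summation of the bounds for the crossing probabilities `Q t` at the levels `x - d + t`, for
`t ≥ 1`.  By convexity of the exponent they are dominated by a geometric series. -/
lemma exists_level_sum_le {n : ℕ} {x : ℝ} (hx0 : 0 < x) (hx : (n : ℝ) ≤ 2 * x ^ 2)
    (hxn : x < n) :
    ∃ d : ℕ, 1 ≤ d ∧ ∀ (N : ℕ) (Q : ℕ → ℝ),
      (∀ t : ℕ, n ≤ x - d + t → Q t ≤ 0) →
      (∀ t : ℕ, 1 ≤ x - d + t → 5 / 4 * (x - d + t) ≤ n →
        Q t ≤ Real.exp (-((2 * (x - d + t) ^ 2 - 119 / 100 * (x - d + t)) / n))) →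
      (∀ t : ℕ, 0 < x - d + t → x - d + t < n →
        Q t ≤ (1 - (x - d + t) / n) ^ (x - d + t)) →
      ∑ t ∈ Icc 1 N, Q t ≤ d * Real.exp (1 - 2 * x ^ 2 / n) := by
  have hn0 : (0 : ℝ) < n := hx0.trans hxn
  have hcrude (v : ℝ) (hv : 0 < v) (hvn : v < n) (h : (n : ℝ) ≤ 5 / 4 * v) :
      (1 - v / n) ^ v ≤ Real.exp (-(2 * v ^ 2 / n)) := by
    have h1 := one_sub_le_exp_neg_two_mul (r := v / n) (by rw [le_div_iff₀ hn0]; linarith)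
    have h2 : 0 ≤ 1 - v / n := by rw [sub_nonneg, div_le_one hn0]; exact hvn.le
    refine (Real.rpow_le_rpow h2 h1 hv.le).trans_eq ?_
    rw [← Real.exp_mul]
    congr 1
    ring
  set θ : ℝ := 4 * x / n with hθ_def
  have hθ : 0 < θ := by positivity
  have hexp : 0 < Real.exp θ - 1 := by
    have := Real.add_one_lt_exp hθ.ne'
    linarith
  have hsum (d N : ℕ) (C : ℝ) (hC : 0 ≤ C) (Q : ℕ → ℝ)
      (hQ : ∀ t : ℕ, 1 ≤ t → Q t ≤ C * Real.exp (-(θ * ((t : ℝ) - d)))) :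
      ∑ t ∈ Icc 1 N, Q t ≤ C * Real.exp (θ * d) / (Real.exp θ - 1) := by
    calc ∑ t ∈ Icc 1 N, Q t
        ≤ ∑ t ∈ Icc 1 N, C * Real.exp (-(θ * ((t : ℝ) - d))) :=
          Finset.sum_le_sum fun t ht => hQ t (Finset.mem_Icc.1 ht).1
      _ = C * Real.exp (θ * d) * ∑ t ∈ Icc 1 N, Real.exp (-(θ * t)) := by
          rw [Finset.mul_sum]
          refine Finset.sum_congr rfl fun t _ => ?_
          rw [mul_assoc, ← Real.exp_add]
          ring_nf
      _ ≤ C * Real.exp (θ * d) * (1 / (Real.exp θ - 1)) := by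
          gcongr
          exact sum_exp_neg_mul_le hθ N
      _ = _ := by ring
  rcases le_or_gt (n : ℝ) (5 / 4 * x) with hlarge | hsmall
  · -- The geometric series is dominated by its first term.
    refine ⟨1, le_rfl, fun N Q hQ1 _ hQ3 => ?_⟩
    have hθ1 : 1 ≤ θ := by rw [hθ_def, le_div_iff₀ hn0]; linarith
    have hE : 2 ≤ Real.exp θ := by have := Real.add_one_le_exp θ; linarith
    refine (hsum 1 N (Real.exp (-(2 * x ^ 2 / n))) (Real.exp_nonneg _) Q fun t ht => ?_).trans ?_
    · have ht' : (1 : ℝ) ≤ t := by exact_mod_cast ht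
      push_cast at hQ1 hQ3 ⊢
      rcases le_or_gt (n : ℝ) (x - 1 + t) with hv | hv
      · exact (hQ1 t hv).trans (by positivity)
      · refine ((hQ3 t (by linarith) hv).trans
          (hcrude _ (by linarith) hv (by linarith))).trans ?_
        rw [← Real.exp_add]
        refine Real.exp_le_exp.2 ?_
        have e : -(2 * x ^ 2 / n) + -(θ * ((t : ℝ) - 1)) - -(2 * (x - 1 + t) ^ 2 / n) =
            2 * ((t : ℝ) - 1) ^ 2 / n := by rw [hθ_def]; field_simp; ring
        have : 0 ≤ 2 * ((t : ℝ) - 1) ^ 2 / n := by positivity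
        linarith
    · rw [Nat.cast_one, mul_one, one_mul, div_le_iff₀ hexp, sub_eq_add_neg 1, add_comm (1 : ℝ),
        Real.exp_add, mul_assoc]
      have e1 := Real.add_one_le_exp (1 : ℝ)
      have e2 : Real.exp θ ≤ Real.exp 1 * (Real.exp θ - 1) := by nlinarith
      exact mul_le_mul_of_nonneg_left e2 (Real.exp_nonneg _)
  rcases Nat.lt_or_ge n 2 with hn2 | hn2
  · have hn1 : n = 1 := by
      have : 0 < n := Nat.cast_pos.1 hn0
      omega
    subst hn1
    refine ⟨1, le_rfl, fun N Q hQ1 _ hQ3 => ?_⟩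
    simp only [Nat.cast_one, div_one, one_mul] at *
    have h1 : Q 1 ≤ Real.exp (1 - 2 * x ^ 2) := by
      have h2 := hQ3 1 (by push_cast; linarith) (by push_cast; linarith)
      simp only [Nat.cast_one, sub_add_cancel] at h2
      have h3 : 1 - x ≤ Real.exp (-x) := by have := Real.add_one_le_exp (-x); linarith
      have h4 := Real.rpow_le_rpow (by linarith) h3 hx0.le
      rw [← Real.exp_mul] at h4
      refine (h2.trans h4).trans (Real.exp_le_exp.2 ?_)
      nlinarith
    calc ∑ t ∈ Icc 1 N, Q t
        ≤ ∑ t ∈ Icc 1 N, if t = 1 then Real.exp (1 - 2 * x ^ 2) else 0 := by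
          refine Finset.sum_le_sum fun t ht => ?_
          split_ifs with h
          · rw [h]; exact h1
          · have : (2 : ℝ) ≤ t := by
              have := (Finset.mem_Icc.1 ht).1
              exact_mod_cast (by omega : 2 ≤ t)
            exact hQ1 t (by linarith)
      _ ≤ Real.exp (1 - 2 * x ^ 2) := by
          rw [Finset.sum_ite_eq']
          split_ifs
          · exact le_rfl
          · positivity
  have hn2' : (2 : ℝ) ≤ n := by exact_mod_cast hn2
  have hx1 : 1 ≤ x := by nlinarith
  obtain ⟨d, hd1, hd2, hd3⟩ := exists_level hθ (by rw [hθ_def, div_le_iff₀ hn0]; linarith)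
  have hdx : (d : ℝ) ≤ x := by
    rcases hd2 with rfl | hd2
    · simpa using hx1
    · refine hd2.trans ?_
      rw [hθ_def, div_le_iff₀ hθ, mul_div_assoc', le_div_iff₀ hn0]
      nlinarith
  refine ⟨d, hd1, fun N Q hQ1 hQ2 hQ3 => ?_⟩
  refine (hsum d N (Real.exp (-((2 * x ^ 2 - 119 / 100 * x) / n))) (Real.exp_nonneg _) Q
    fun t ht => ?_).trans ?_
  · have ht' : (1 : ℝ) ≤ t := by exact_mod_cast ht
    have hv1 : 1 ≤ x - d + t := by linarith
    have h1 : Q t ≤ Real.exp (-((2 * (x - d + t) ^ 2 - 119 / 100 * (x - d + t)) / n)) := by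
      rcases le_or_gt (n : ℝ) (x - d + t) with hv | hv
      · exact (hQ1 t hv).trans (Real.exp_nonneg _)
      rcases le_or_gt (5 / 4 * (x - d + t)) n with hv' | hv'
      · exact hQ2 t hv1 hv'
      · refine ((hQ3 t (by linarith) hv).trans
          (hcrude _ (by linarith) hv hv'.le)).trans (Real.exp_le_exp.2 ?_)
        gcongr
        linarith
    refine h1.trans ?_
    rw [← Real.exp_add]
    refine Real.exp_le_exp.2 ?_
    have e : -((2 * x ^ 2 - 119 / 100 * x) / n) + -(θ * ((t : ℝ) - d)) -
        -((2 * (x - d + t) ^ 2 - 119 / 100 * (x - d + t)) / n) =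
        (2 * ((t : ℝ) - d) ^ 2 - 119 / 100 * ((t : ℝ) - d)) / n := by
      rw [hθ_def]; field_simp; ring
    -- The quadratic is nonnegative at the integer `t - d`.
    have hint : 0 ≤ 2 * ((t : ℝ) - d) ^ 2 - 119 / 100 * ((t : ℝ) - d) := by
      rcases Nat.lt_or_ge d t with h | h
      · have : (d : ℝ) + 1 ≤ t := by exact_mod_cast h
        nlinarith
      · have : (t : ℝ) ≤ d := by exact_mod_cast h
        nlinarith
    have := div_nonneg hint hn0.le
    linarith
  · rw [div_le_iff₀ hexp]
    have e : Real.exp (-((2 * x ^ 2 - 119 / 100 * x) / n)) =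
        Real.exp (-(2 * x ^ 2 / n)) * Real.exp (119 / 400 * θ) := by
      rw [← Real.exp_add, hθ_def]; congr 1; field_simp; ring
    rw [e, mul_assoc, sub_eq_add_neg 1, add_comm (1 : ℝ), Real.exp_add]
    calc _ ≤ Real.exp (-(2 * x ^ 2 / n)) * (Real.exp 1 * d * (Real.exp θ - 1)) :=
          mul_le_mul_of_nonneg_left hd3 (Real.exp_nonneg _)
      _ = _ := by ring

/-! ### Comparison of products of weights with identically distributed ones -/

/-- The expectation of `Ψ` under the product of the (possibly signed) weights `p i` on `C`. -/
noncomputable def prodSum {ι C : Type*} [Fintype ι] [DecidableEq ι] [Fintype C]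
    (Ψ : (ι → C) → ℝ) (p : ι → C → ℝ) : ℝ :=
  ∑ f : ι → C, (∏ i, p i (f i)) * Ψ f

lemma sum_sum_update {ι C : Type*} [Fintype ι] [DecidableEq ι] [Fintype C]
    (X : (ι → C) → ℝ) (i : ι) :
    ∑ f : ι → C, ∑ c, X (Function.update f i c) = Fintype.card C * ∑ f, X f := by
  have hinv : Function.Involutive
      fun x : (ι → C) × C => (Function.update x.1 i x.2, x.1 i) := by
    rintro ⟨f, c⟩
    simp
  rw [← Fintype.sum_prod_type' (f := fun (f : ι → C) c => X (Function.update f i c))]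
  rw [Fintype.sum_equiv hinv.toPerm (fun x : (ι → C) × C => X (Function.update x.1 i x.2))
    (fun x => X x.1) fun x => rfl, Fintype.sum_prod_type]
  simp [Finset.mul_sum]

/-- Replacing the rows `i` and `j` by their average. -/
noncomputable def avgRows {ι C : Type*} [DecidableEq ι] (p : ι → C → ℝ) (i j k : ι) (c : C) :
    ℝ :=
  if k = i ∨ k = j then (p i c + p j c) / 2 else p k c

lemma prod_eq_mul_mul_prod_erase {ι : Type*} [Fintype ι] [DecidableEq ι] {i j : ι}
    (hij : i ≠ j) (g : ι → ℝ) :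
    ∏ k, g k = g i * g j * ∏ k ∈ (univ.erase i).erase j, g k := by
  rw [mul_assoc, Finset.mul_prod_erase _ g (Finset.mem_erase.2 ⟨hij.symm, Finset.mem_univ j⟩),
    Finset.mul_prod_erase _ g (Finset.mem_univ i)]

/-- If `Ψ` is symmetric, and positive semidefinite on zero-sum weights as a function of any two
coordinates, then averaging two of the factors does not decrease the expectation of `Ψ`. -/
lemma prodSum_le_prodSum_avgRows {ι C : Type*} [Fintype ι] [DecidableEq ι] [Fintype C]
    {Ψ : (ι → C) → ℝ} {i j : ι} (hij : i ≠ j)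
    (hpair : ∀ f, ∀ ν : C → ℝ, ∑ c, ν c = 0 →
      0 ≤ ∑ c, ∑ c', ν c * ν c' * Ψ (Function.update (Function.update f i c) j c'))
    (hsymm : ∀ f c c', Ψ (Function.update (Function.update f i c) j c') =
      Ψ (Function.update (Function.update f i c') j c))
    {p : ι → C → ℝ} (hp0 : ∀ k c, 0 ≤ p k c) (hp1 : ∑ c, p i c = ∑ c, p j c) :
    prodSum Ψ p ≤ prodSum Ψ (avgRows p i j) := by
  set w : (ι → C) → ℝ := fun f => ∏ k ∈ (univ.erase i).erase j, p k (f k) with hw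
  set m : C → ℝ := fun c => (p i c + p j c) / 2 with hm
  have e : prodSum Ψ (avgRows p i j) - prodSum Ψ p =
      ∑ f, (m (f i) * m (f j) - p i (f i) * p j (f j)) * (w f * Ψ f) := by
    rw [prodSum, prodSum, ← Finset.sum_sub_distrib]
    refine Finset.sum_congr rfl fun f _ => ?_
    rw [prod_eq_mul_mul_prod_erase hij fun k => avgRows p i j k (f k),
      prod_eq_mul_mul_prod_erase hij fun k => p k (f k)]
    have h1 : ∏ k ∈ (univ.erase i).erase j, avgRows p i j k (f k) = w f := by
      refine Finset.prod_congr rfl fun k hk => ?_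
      simp only [Finset.mem_erase, Finset.mem_univ, and_true] at hk
      simp [avgRows, hk.1, hk.2]
    rw [h1]
    simp only [avgRows, true_or, or_true, if_true, hm, hw]
    ring
  rcases isEmpty_or_nonempty C with hC | hC
  · have : IsEmpty (ι → C) := ⟨fun f => hC.elim (f i)⟩
    simp [prodSum]
  have hcard : (0 : ℝ) < Fintype.card C := Nat.cast_pos.2 Fintype.card_pos
  suffices h : 0 ≤ (Fintype.card C : ℝ) * (Fintype.card C *
      (prodSum Ψ (avgRows p i j) - prodSum Ψ p)) by
    have h1 := nonneg_of_mul_nonneg_right h hcard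
    have h2 := nonneg_of_mul_nonneg_right h1 hcard
    linarith
  rw [e, ← sum_sum_update _ j, ← sum_sum_update _ i]
  refine Finset.sum_nonneg fun f _ => ?_
  have hwf (c c' : C) : w (Function.update (Function.update f i c) j c') = w f := by
    refine Finset.prod_congr rfl fun k hk => ?_
    simp only [Finset.mem_erase, Finset.mem_univ, and_true] at hk
    rw [Function.update_of_ne hk.1, Function.update_of_ne hk.2]
  have hi (c c' : C) : Function.update (Function.update f i c) j c' i = c := by
    rw [Function.update_of_ne hij, Function.update_self]
  simp only [hwf, hi, Function.update_self]
  set A : C → C → ℝ := fun c c' => Ψ (Function.update (Function.update f i c) j c') with hA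
  set ν : C → ℝ := fun c => (p i c - p j c) / 2 with hν
  have hν0 : ∑ c, ν c = 0 := by
    rw [hν, ← Finset.sum_div, Finset.sum_sub_distrib, hp1, sub_self, zero_div]
  have h1 : ∑ c, ∑ c', (m c * m c' - p i c * p j c') * (w f * A c c') =
      w f * (∑ c, ∑ c', ν c * ν c' * A c c' +
        (∑ c, ∑ c', m c * ν c' * A c c' - ∑ c, ∑ c', ν c * m c' * A c c')) := by
    simp only [← Finset.sum_sub_distrib, ← Finset.sum_add_distrib, Finset.mul_sum]
    refine Finset.sum_congr rfl fun c _ => Finset.sum_congr rfl fun c' _ => ?_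
    simp only [hm, hν]
    ring
  have h2 : ∑ c, ∑ c', m c * ν c' * A c c' = ∑ c, ∑ c', ν c * m c' * A c c' := by
    rw [Finset.sum_comm]
    refine Finset.sum_congr rfl fun c _ => Finset.sum_congr rfl fun c' _ => ?_
    rw [hA]
    simp only
    rw [hsymm f c' c]
    ring
  rw [h1, h2, sub_self, add_zero]
  exact mul_nonneg (Finset.prod_nonneg fun k _ => hp0 _ _) (hpair f ν hν0)

lemma avgRows_nonneg {ι C : Type*} [DecidableEq ι] {p : ι → C → ℝ}
    (hp0 : ∀ k c, 0 ≤ p k c) (i j k : ι) (c : C) : 0 ≤ avgRows p i j k c := by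
  have h1 := hp0 i c
  have h2 := hp0 j c
  have h3 := hp0 k c
  unfold avgRows
  split_ifs
  · positivity
  · exact h3

lemma sum_avgRows_sub {ι C : Type*} [Fintype ι] [DecidableEq ι] (p : ι → C → ℝ)
    {i j : ι} (hij : i ≠ j) (φ : (C → ℝ) → ℝ) :
    ∑ k, φ (avgRows p i j k) - ∑ k, φ (p k) =
      2 * φ (fun c => (p i c + p j c) / 2) - φ (p i) - φ (p j) := by
  have hi : avgRows p i j i = fun c => (p i c + p j c) / 2 := by ext c; simp [avgRows]
  have hj : avgRows p i j j = fun c => (p i c + p j c) / 2 := by ext c; simp [avgRows]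
  rw [← Finset.sum_sub_distrib, Fintype.sum_eq_add i j hij, hi, hj]
  · ring
  · rintro k ⟨h1, h2⟩
    have : avgRows p i j k = p k := by ext c; simp [avgRows, h1, h2]
    rw [this, sub_self]

/-- Comparison with the identically distributed case: among all families of probability vectors
with given average, the expectation of `Ψ` is maximal when all factors are equal.  A maximizer
that minimizes the sum of squares has equal rows, by averaging two of them. -/
theorem prodSum_le_prodSum_const {ι C : Type*} [Fintype ι] [DecidableEq ι] [Fintype C]
    [Nonempty ι] {Ψ : (ι → C) → ℝ}
    (hpair : ∀ i j, i ≠ j → ∀ f, ∀ ν : C → ℝ, ∑ c, ν c = 0 →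
      0 ≤ ∑ c, ∑ c', ν c * ν c' * Ψ (Function.update (Function.update f i c) j c'))
    (hsymm : ∀ i j, i ≠ j → ∀ f c c', Ψ (Function.update (Function.update f i c) j c') =
      Ψ (Function.update (Function.update f i c') j c))
    {p : ι → C → ℝ} (hp0 : ∀ k c, 0 ≤ p k c) (hp1 : ∀ k, ∑ c, p k c = 1) :
    prodSum Ψ p ≤ prodSum Ψ fun _ c => (∑ k, p k c) / Fintype.card ι := by
  set K : Set (ι → C → ℝ) := {x | (∀ k c, 0 ≤ x k c) ∧ (∀ k, ∑ c, x k c = 1) ∧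
    ∀ c, ∑ k, x k c = ∑ k, p k c} with hK
  have hKc : IsCompact K := by
    refine (isCompact_Icc (a := (0 : ι → C → ℝ)) (b := 1)).of_isClosed_subset ?_ ?_
    · have hKeq : K = (⋂ k, ⋂ c, {x | 0 ≤ x k c}) ∩ ((⋂ k, {x | ∑ c, x k c = 1}) ∩
          ⋂ c, {x | ∑ k, x k c = ∑ k, p k c}) := by
        ext x
        simp [hK]
      rw [hKeq]
      refine IsClosed.inter ?_ (IsClosed.inter ?_ ?_)
      · exact isClosed_iInter fun k => isClosed_iInter fun c =>
          isClosed_le continuous_const (by fun_prop)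
      · exact isClosed_iInter fun k => isClosed_eq (by fun_prop) continuous_const
      · exact isClosed_iInter fun c => isClosed_eq (by fun_prop) continuous_const
    · rintro x ⟨h1, h2, -⟩
      refine ⟨fun k c => h1 k c, fun k c => ?_⟩
      rw [Pi.one_apply, Pi.one_apply, ← h2 k]
      exact Finset.single_le_sum (fun c _ => h1 k c) (Finset.mem_univ c)
  have hKavg : ∀ x ∈ K, ∀ i j, i ≠ j → avgRows x i j ∈ K := by
    rintro x ⟨h1, h2, h3⟩ i j hij
    refine ⟨avgRows_nonneg h1 i j, fun k => ?_, fun c => ?_⟩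
    · by_cases h : k = i ∨ k = j
      · simp only [avgRows, h, if_true]
        rw [← Finset.sum_div, Finset.sum_add_distrib, h2, h2]
        norm_num
      · simp only [avgRows, h, if_false]
        exact h2 k
    · have := sum_avgRows_sub x hij fun r => r c
      rw [← h3]
      simp only at this
      linarith
  have hT : Continuous (prodSum Ψ) := by
    unfold prodSum
    fun_prop
  obtain ⟨x, hxK, hx⟩ := hKc.exists_isMaxOn ⟨p, hp0, hp1, fun _ => rfl⟩ hT.continuousOn
  obtain ⟨y, ⟨hyK, hyT⟩, hy⟩ := (hKc.inter_right (isClosed_eq hT continuous_const :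
    IsClosed {y | prodSum Ψ y = prodSum Ψ x})).exists_isMinOn ⟨x, hxK, rfl⟩
    (f := fun y : ι → C → ℝ => ∑ k, ∑ c, y k c ^ 2) (by fun_prop)
  have hrows : ∀ i j, y i = y j := by
    intro i j
    by_contra hne
    have hij : i ≠ j := fun h => hne (by rw [h])
    have hmem : avgRows y i j ∈ K ∩ {y | prodSum Ψ y = prodSum Ψ x} := by
      refine ⟨hKavg y hyK i j hij, le_antisymm (hx (hKavg y hyK i j hij)) ?_⟩
      have h1 := prodSum_le_prodSum_avgRows hij (hpair i j hij) (hsymm i j hij) hyK.1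
        ((hyK.2.1 i).trans (hyK.2.1 j).symm)
      exact (show prodSum Ψ y = prodSum Ψ x from hyT) ▸ h1
    have h1 : ∑ k, ∑ c, y k c ^ 2 ≤ ∑ k, ∑ c, avgRows y i j k c ^ 2 := hy hmem
    have h2 := sum_avgRows_sub y hij fun r => ∑ c, r c ^ 2
    have h3 : 2 * ∑ c, ((y i c + y j c) / 2) ^ 2 - ∑ c, y i c ^ 2 - ∑ c, y j c ^ 2 =
        -(∑ c, (y i c - y j c) ^ 2 / 2) := by
      rw [Finset.mul_sum, ← Finset.sum_sub_distrib, ← Finset.sum_sub_distrib,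
        ← Finset.sum_neg_distrib]
      exact Finset.sum_congr rfl fun c _ => by ring
    have h4 : 0 < ∑ c, (y i c - y j c) ^ 2 / 2 := by
      obtain ⟨c, hc⟩ := Function.ne_iff.1 hne
      refine Finset.sum_pos' (fun c _ => by positivity) ⟨c, Finset.mem_univ c, ?_⟩
      have := sub_ne_zero.2 hc
      positivity
    simp only at h2
    linarith
  have hyeq : y = fun _ c => (∑ k, p k c) / Fintype.card ι := by
    ext i c
    rw [← hyK.2.2 c, Finset.sum_congr rfl fun k _ => congrFun (hrows k i) c]
    simp
  rw [← hyeq, show prodSum Ψ y = prodSum Ψ x from hyT]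
  exact hx ⟨hp0, hp1, fun _ => rfl⟩

/-! ### The combinatorial form of the one-sided Bretagnolle inequality -/

open scoped Classical in
/-- The positive part of the maximum over `k ∈ K` of `s k + 1{c ≤ k} + 1{c' ≤ k}` is, as a function
of `c` and `c'`, the sum of two functions of one variable and of a product `β c * β c'`.  The
positive part is written as a sum of indicators of superlevel sets. -/
lemma exists_pair_form (K : Finset ℕ) (s : ℕ → ℤ) {N : ℕ} (hs : ∀ k ∈ K, s k + 2 ≤ N)
    (hN : 2 ≤ N) :
    ∃ (l : ℝ) (α β : ℕ → ℝ), ∀ c c' : ℕ,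
      ∑ t ∈ Icc 1 N, (if ∃ k ∈ K, (t : ℤ) ≤ s k + (if c ≤ k then 1 else 0) +
        (if c' ≤ k then 1 else 0) then (1 : ℝ) else 0) = l + α c + α c' + β c * β c' := by
  obtain ⟨L, hL1, hL2⟩ : ∃ L : ℕ, (∀ k ∈ K, s k ≤ L) ∧ (L = 0 ∨ ∃ k ∈ K, s k = L) := by
    refine ⟨K.sup fun k => (s k).toNat, fun k hk => ?_, ?_⟩
    · have h : (s k).toNat ≤ K.sup fun k => (s k).toNat :=
        Finset.le_sup (f := fun k => (s k).toNat) hk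
      omega
    · rcases K.eq_empty_or_nonempty with rfl | hK
      · simp
      · obtain ⟨k, hk, h⟩ : ∃ k ∈ K, (K.sup fun k => (s k).toNat) = (s k).toNat :=
          Finset.exists_mem_eq_sup K hK fun k => (s k).toNat
        rcases Nat.eq_zero_or_pos (K.sup fun k => (s k).toNat) with h0 | h0
        · exact Or.inl h0
        · exact Or.inr ⟨k, hk, by omega⟩
  have hLN : L + 2 ≤ N := by
    rcases hL2 with h | ⟨k, hk, h⟩
    · omega
    · have := hs k hk
      omega
  set a : ℕ → Prop := fun c => ∃ k ∈ K, c ≤ k ∧ s k = L with ha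
  set b : ℕ → Prop := fun c => ¬ a c ∧ ∃ k ∈ K, c ≤ k ∧ s k = L - 1 with hb
  refine ⟨L, fun c => if a c then 1 else 0, fun c => if b c then 1 else 0, fun c c' => ?_⟩
  have h1 : (∃ k ∈ K, ((L + 1 : ℕ) : ℤ) ≤ s k + (if c ≤ k then 1 else 0) +
      (if c' ≤ k then 1 else 0)) ↔ a c ∨ a c' ∨ (b c ∧ b c') := by
    constructor
    · rintro ⟨k, hk, h⟩
      have := hL1 k hk
      by_cases hac : a c
      · exact Or.inl hac
      by_cases hac' : a c'
      · exact Or.inr (Or.inl hac')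
      have h2 : ¬ (c ≤ k ∧ s k = L) := fun h' => hac ⟨k, hk, h'⟩
      have h3 : ¬ (c' ≤ k ∧ s k = L) := fun h' => hac' ⟨k, hk, h'⟩
      push_cast at h
      refine Or.inr (Or.inr ⟨⟨hac, k, hk, ?_⟩, ⟨hac', k, hk, ?_⟩⟩) <;>
        (split_ifs at h <;> constructor <;> omega)
    · rintro (⟨k, hk, h, h'⟩ | ⟨k, hk, h, h'⟩ | ⟨⟨_, k, hk, h, h'⟩, ⟨_, l, hl, g, g'⟩⟩)
      · refine ⟨k, hk, ?_⟩
        rw [if_pos h]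
        push_cast
        split_ifs <;> omega
      · refine ⟨k, hk, ?_⟩
        rw [if_pos h]
        push_cast
        split_ifs <;> omega
      · refine ⟨max k l, ?_, ?_⟩
        · rcases max_choice k l with e | e <;> rw [e] <;> assumption
        · rw [if_pos (h.trans (le_max_left _ _)), if_pos (g.trans (le_max_right _ _))]
          push_cast
          rcases max_choice k l with e | e <;> rw [e] <;> omega
  have h2 : (∃ k ∈ K, ((L + 2 : ℕ) : ℤ) ≤ s k + (if c ≤ k then 1 else 0) +
      (if c' ≤ k then 1 else 0)) ↔ a c ∧ a c' := by
    constructor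
    · rintro ⟨k, hk, h⟩
      have := hL1 k hk
      push_cast at h
      refine ⟨⟨k, hk, ?_⟩, ⟨k, hk, ?_⟩⟩ <;> (split_ifs at h <;> constructor <;> omega)
    · rintro ⟨⟨k, hk, h, h'⟩, ⟨l, hl, g, g'⟩⟩
      refine ⟨max k l, ?_, ?_⟩
      · rcases max_choice k l with e | e <;> rw [e] <;> assumption
      · rw [if_pos (h.trans (le_max_left _ _)), if_pos (g.trans (le_max_right _ _))]
        push_cast
        rcases max_choice k l with e | e <;> rw [e] <;> omega
  have h3 (t : ℕ) (ht : t ∈ Icc 1 N) :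
      (if ∃ k ∈ K, (t : ℤ) ≤ s k + (if c ≤ k then 1 else 0) + (if c' ≤ k then 1 else 0)
        then (1 : ℝ) else 0) = (if t ∈ Icc 1 L then 1 else 0) +
      (if t = L + 1 then (if a c ∨ a c' ∨ (b c ∧ b c') then 1 else 0) else 0) +
      (if t = L + 2 then (if a c ∧ a c' then 1 else 0) else 0) := by
    have ht1 := (Finset.mem_Icc.1 ht).1
    rcases lt_trichotomy t (L + 1) with h | h | h
    · have hex : ∃ k ∈ K, (t : ℤ) ≤ s k + (if c ≤ k then 1 else 0) +
          (if c' ≤ k then 1 else 0) := by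
        rcases hL2 with h0 | ⟨k, hk, h0⟩
        · omega
        · exact ⟨k, hk, by split_ifs <;> omega⟩
      rw [if_pos hex, if_pos (Finset.mem_Icc.2 ⟨ht1, by omega⟩), if_neg h.ne,
        if_neg (by omega)]
      norm_num
    · subst h
      have e1 : ¬ (L + 1 ∈ Icc 1 L) := fun h => by have := (Finset.mem_Icc.1 h).2; omega
      have e2 : ¬ (L + 1 = L + 2) := by omega
      simp only [h1, e1, e2, if_true, if_false, zero_add, add_zero]
    · have e1 : ¬ (t ∈ Icc 1 L) := fun h => by have := (Finset.mem_Icc.1 h).2; omega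
      have e2 : ¬ (t = L + 1) := by omega
      by_cases h' : t = L + 2
      · subst h'
        simp only [h2, e1, e2, if_true, if_false, zero_add]
      · have e3 : ¬ ∃ k ∈ K, (t : ℤ) ≤ s k + (if c ≤ k then 1 else 0) +
            (if c' ≤ k then 1 else 0) := by
          rintro ⟨k, hk, hk'⟩
          have := hL1 k hk
          split_ifs at hk' <;> omega
        simp only [e1, e2, e3, h', if_false, add_zero]
  rw [Finset.sum_congr rfl h3, Finset.sum_add_distrib, Finset.sum_add_distrib,
    Finset.sum_ite_eq', Finset.sum_ite_eq', if_pos (Finset.mem_Icc.2 ⟨by omega, by omega⟩),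
    if_pos (Finset.mem_Icc.2 ⟨by omega, by omega⟩), Finset.sum_ite_mem,
    Finset.inter_eq_right.2 (Finset.Icc_subset_Icc_right (by omega))]
  have h4 : b c → ¬ a c := fun h => h.1
  have h5 : b c' → ¬ a c' := fun h => h.1
  simp only [Finset.sum_const, Nat.card_Icc, Nat.add_sub_cancel, nsmul_eq_mul, mul_one]
  by_cases ac : a c <;> by_cases ac' : a c' <;> by_cases bc : b c <;> by_cases bc' : b c' <;>
    simp only [ac, ac', bc, bc', not_true, not_false_eq_true, imp_false, or_true,
      or_false, and_true, and_false, if_true, if_false, or_self,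
      and_self] at h4 h5 ⊢ <;> ring

/-- A function of the form `l + α c + α c' + β c β c'` is positive semidefinite on weights of sum
zero. -/
lemma sum_sum_mul_pair_form_nonneg {C : Type*} [Fintype C] (ν : C → ℝ) (hν : ∑ c, ν c = 0)
    (l : ℝ) (α β : C → ℝ) :
    0 ≤ ∑ c, ∑ c', ν c * ν c' * (l + α c + α c' + β c * β c') := by
  have h : ∑ c, ∑ c', ν c * ν c' * (l + α c + α c' + β c * β c') =
      ∑ c, (ν c * (l + α c) * ∑ c', ν c' + ν c * ∑ c', ν c' * α c' +
        (ν c * β c) * ∑ c', ν c' * β c') := by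
    refine Finset.sum_congr rfl fun c _ => ?_
    simp only [Finset.mul_sum, ← Finset.sum_add_distrib]
    exact Finset.sum_congr rfl fun c' _ => by ring
  rw [h, hν]
  simp only [mul_zero, zero_add, Finset.sum_add_distrib, ← Finset.sum_mul]
  rw [hν, zero_mul, zero_add]
  exact mul_self_nonneg _

lemma card_update_update_le {n M : ℕ} {i j : Fin n} (hij : i ≠ j) (f : Fin n → Fin M)
    (c c' : Fin M) (k : ℕ) :
    #{l | (Function.update (Function.update f i c) j c' l : ℕ) ≤ k} =
      #{l ∈ (univ.erase i).erase j | (f l : ℕ) ≤ k} + (if (c : ℕ) ≤ k then 1 else 0) +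
        (if (c' : ℕ) ≤ k then 1 else 0) := by
  rw [Finset.card_filter, Finset.card_filter]
  rw [← Finset.add_sum_erase univ _ (Finset.mem_univ i),
    ← Finset.add_sum_erase (univ.erase i) _ (Finset.mem_erase.2 ⟨hij.symm, Finset.mem_univ j⟩)]
  have h : ∀ l ∈ (univ.erase i).erase j,
      (if (Function.update (Function.update f i c) j c' l : ℕ) ≤ k then 1 else 0) =
        if (f l : ℕ) ≤ k then 1 else 0 := by
    intro l hl
    simp only [Finset.mem_erase, Finset.mem_univ, and_true] at hl
    rw [Function.update_of_ne hl.1, Function.update_of_ne hl.2]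
  rw [Finset.sum_congr rfl h, Function.update_self, Function.update_of_ne hij,
    Function.update_self]
  ring

open scoped Classical in
/-- The positive part of `d + max (#{i | f i ≤ k} - k)`, the maximum being over `k ∈ K`, written as
a sum of indicators of superlevel sets.  The sum is complete if `n + d ≤ N`. -/
noncomputable def excess (K : Finset ℕ) (d N : ℕ) {n M : ℕ} (f : Fin n → Fin M) : ℝ :=
  ∑ t ∈ Icc 1 N, if ∃ k ∈ K, k + t ≤ #{l | (f l : ℕ) ≤ k} + d then 1 else 0

lemma excess_update_update {K : Finset ℕ} {d N n M : ℕ} (hN : n + d + 2 ≤ N) {i j : Fin n}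
    (hij : i ≠ j) (f : Fin n → Fin M) :
    ∃ (l : ℝ) (α β : ℕ → ℝ), ∀ c c' : Fin M,
      excess K d N (Function.update (Function.update f i c) j c') =
        l + α c + α c' + β c * β c' := by
  obtain ⟨l, α, β, h⟩ := exists_pair_form K
    (fun k => (#{l ∈ (univ.erase i).erase j | (f l : ℕ) ≤ k} : ℤ) + d - k) (N := N)
    (fun k _ => by
      have h1 : #{l ∈ (univ.erase i).erase j | (f l : ℕ) ≤ k} ≤ n := by
        refine (Finset.card_le_univ _).trans_eq (Fintype.card_fin n)
      omega) (by omega)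
  refine ⟨l, α, β, fun c c' => ?_⟩
  rw [← h c c', excess]
  refine Finset.sum_congr rfl fun t _ => ?_
  congr 1
  rw [eq_iff_iff]
  refine exists_congr fun k => and_congr_right fun _ => ?_
  rw [card_update_update_le hij]
  split_ifs <;> omega

lemma excess_nonneg (K : Finset ℕ) (d N : ℕ) {n M : ℕ} (f : Fin n → Fin M) :
    0 ≤ excess K d N f :=
  Finset.sum_nonneg fun t _ => by split_ifs <;> norm_num

lemma le_excess {K : Finset ℕ} {d N n M : ℕ} (hdN : d ≤ N) (f : Fin n → Fin M)
    (h : ∃ k ∈ K, k ≤ #{l | (f l : ℕ) ≤ k}) : (d : ℝ) ≤ excess K d N f := by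
  classical
  obtain ⟨k, hk, h⟩ := h
  calc (d : ℝ) = ∑ t ∈ Icc 1 d, (1 : ℝ) := by simp
    _ ≤ ∑ t ∈ Icc 1 d, if ∃ k ∈ K, k + t ≤ #{l | (f l : ℕ) ≤ k} + d then (1 : ℝ) else 0 := by
      refine Finset.sum_le_sum fun t ht => ?_
      rw [if_pos ⟨k, hk, add_le_add h (Finset.mem_Icc.1 ht).2⟩]
    _ ≤ ∑ t ∈ Icc 1 N, if ∃ k ∈ K, k + t ≤ #{l | (f l : ℕ) ≤ k} + d then (1 : ℝ) else 0 :=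
      Finset.sum_le_sum_of_subset_of_nonneg (Finset.Icc_subset_Icc_right hdN)
        fun t _ _ => by split_ifs <;> norm_num
    _ = excess K d N f := by
      rw [excess]

lemma card_le_add_card_lt {n M : ℕ} (f : Fin n → Fin M) (c : Fin M) :
    #{l | (f l : ℕ) ≤ (c : ℕ)} + #{i | c < f i} = n := by
  have := Finset.card_filter_add_card_filter_not (s := (univ : Finset (Fin n)))
    (fun l => (f l : ℕ) ≤ (c : ℕ))
  rw [Finset.card_univ, Fintype.card_fin] at this
  simpa only [not_le, Fin.val_fin_lt] using this

open scoped Classical in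
/-- Under identical distributions, the superlevel sets of `excess` are crossing events. -/
lemma prodSum_excess_const {K : Finset ℕ} {d N n M : ℕ} (hK : ∀ k ∈ K, k < M) (q : Fin M → ℝ) :
    (prodSum (excess K d N) fun _ : Fin n => q) = ∑ t ∈ Icc 1 N,
      ∑ f : Fin n → Fin M, (∏ i, q (f i)) *
        (if ∃ c : Fin M, (c : ℕ) ∈ K ∧ (c : ℕ) + t + #{i | c < f i} ≤ n + d
          then 1 else 0) := by
  rw [Finset.sum_comm, prodSum]
  refine Finset.sum_congr rfl fun f _ => ?_
  rw [excess, Finset.mul_sum]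
  refine Finset.sum_congr rfl fun t _ => ?_
  congr 2
  rw [eq_iff_iff]
  constructor
  · rintro ⟨k, hk, h⟩
    have h1 := card_le_add_card_lt f ⟨k, hK k hk⟩
    refine ⟨⟨k, hK k hk⟩, hk, ?_⟩
    simp only at h1 ⊢
    omega
  · rintro ⟨c, hc, h⟩
    have := card_le_add_card_lt f c
    exact ⟨c, hc, by omega⟩

lemma tail_weight_ge {K : Finset ℕ} {x : ℝ} {d t n M : ℕ} (hn0 : (0 : ℝ) < n)
    (hKx : ∀ k ∈ K, k ≤ n ∧ x < k) {p : Fin n → Fin M → ℝ} (hp1 : ∀ i, ∑ c, p i c = 1)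
    (hcol : ∀ k : ℕ, x < k → k ≤ n →
      ∑ i, ∑ c ∈ univ.filter (fun c : Fin M => (c : ℕ) ≤ k), p i c ≤ k - x)
    {c : Fin M} {R : ℕ} (hc : (c : ℕ) ∈ K) (hR : (c : ℕ) + t + R ≤ n + d) :
    R + (x - d + t) ≤ n * ∑ c' with c < c', (∑ i, p i c') / n := by
  obtain ⟨hcn, hcx⟩ := hKx _ hc
  rw [← Finset.sum_div, mul_div_cancel₀ _ hn0.ne', Finset.sum_comm]
  have h1 (i : Fin n) : ∑ c' with c < c', p i c' =
      1 - ∑ c' ∈ univ.filter (fun c' : Fin M => (c' : ℕ) ≤ c), p i c' := by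
    rw [← hp1 i, ← Finset.sum_filter_add_sum_filter_not univ fun c' : Fin M => (c' : ℕ) ≤ c]
    simp only [not_le, Fin.val_fin_lt, add_sub_cancel_left]
  have h2 := hcol c hcx hcn
  have hR' : ((c : ℕ) : ℝ) + t + R ≤ n + d := by exact_mod_cast hR
  simp only [h1, Finset.sum_sub_distrib, Finset.sum_const, Finset.card_univ, Fintype.card_fin,
    nsmul_eq_mul, mul_one]
  linarith

open scoped Classical in
/-- Bretagnolle's inequality in its combinatorial form: independent points with values in the cells
`0, …, n + 1`, such that the expected number of points in the cells up to `k` is at most `k - x`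
for `x < k ≤ n`.  The probability that for some such `k` at least `k` points are in the cells up to
`k` is at most `exp (1 - 2 x² / n)`. -/
theorem crossing_prob_le_exp {n : ℕ} {x : ℝ} (hx0 : 0 < x) (hx : (n : ℝ) ≤ 2 * x ^ 2)
    (hxn : x < n) {p : Fin n → Fin (n + 2) → ℝ} (hp0 : ∀ i c, 0 ≤ p i c)
    (hp1 : ∀ i, ∑ c, p i c = 1)
    (hcol : ∀ k : ℕ, x < k → k ≤ n →
      ∑ i, ∑ c ∈ univ.filter (fun c : Fin (n + 2) => (c : ℕ) ≤ k), p i c ≤ k - x) :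
    ∑ f : Fin n → Fin (n + 2), (∏ i, p i (f i)) *
        (if ∃ k : ℕ, x < k ∧ k ≤ n ∧ k ≤ #{i | (f i : ℕ) ≤ k} then 1 else 0) ≤
      Real.exp (1 - 2 * x ^ 2 / n) := by
  have hn0 : (0 : ℝ) < n := hx0.trans hxn
  have hn : 0 < n := Nat.cast_pos.1 hn0
  have : Nonempty (Fin n) := ⟨⟨0, hn⟩⟩
  obtain ⟨d, hd, hsum⟩ := exists_level_sum_le hx0 hx hxn
  have hd0 : (0 : ℝ) < d := by exact_mod_cast hd
  set K : Finset ℕ := {k ∈ range (n + 1) | x < (k : ℝ)} with hK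
  have hmemK (k : ℕ) : k ∈ K ↔ k ≤ n ∧ x < k := by
    rw [hK, Finset.mem_filter, Finset.mem_range, Nat.lt_succ_iff]
  set N : ℕ := n + d + 2 with hN
  set q : Fin (n + 2) → ℝ := fun c => (∑ i, p i c) / n with hq
  have hq0 : ∀ c, 0 ≤ q c := fun c => div_nonneg (Finset.sum_nonneg fun i _ => hp0 i c) hn0.le
  have hq1 : ∑ c, q c = 1 := by
    rw [hq, ← Finset.sum_div, Finset.sum_comm]
    simp only [hp1, Finset.sum_const, Finset.card_univ, Fintype.card_fin, nsmul_eq_mul, mul_one]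
    exact div_self hn0.ne'
  have hstep1 : d * ∑ f : Fin n → Fin (n + 2), (∏ i, p i (f i)) *
      (if ∃ k : ℕ, x < k ∧ k ≤ n ∧ k ≤ #{i | (f i : ℕ) ≤ k} then 1 else 0) ≤
      prodSum (excess K d N) p := by
    rw [prodSum, Finset.mul_sum]
    refine Finset.sum_le_sum fun f _ => ?_
    rw [mul_left_comm]
    refine mul_le_mul_of_nonneg_left ?_ (Finset.prod_nonneg fun i _ => hp0 _ _)
    split_ifs with h
    · obtain ⟨k, hk1, hk2, hk3⟩ := h
      rw [mul_one]
      exact le_excess (by omega) f ⟨k, (hmemK k).2 ⟨hk2, hk1⟩, hk3⟩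
    · rw [mul_zero]
      exact excess_nonneg K d N f
  have hstep2 : prodSum (excess K d N) p ≤ prodSum (excess K d N) fun _ : Fin n => q := by
    have h := prodSum_le_prodSum_const (Ψ := excess K d N) (fun i j hij f ν hν => ?_)
      (fun i j hij f c c' => ?_) hp0 hp1
    · simpa only [hq, Fintype.card_fin] using h
    · obtain ⟨l, α, β, h⟩ := excess_update_update (K := K) hN.ge hij f
      simp only [h]
      exact sum_sum_mul_pair_form_nonneg ν hν l (fun c => α c) fun c => β c
    · obtain ⟨l, α, β, h⟩ := excess_update_update (K := K) hN.ge hij f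
      rw [h, h]
      ring
  have hstep3 := prodSum_excess_const (n := n) (d := d) (N := N)
    (fun k hk => Nat.lt_succ_of_le (Nat.le_succ_of_le ((hmemK k).1 hk).1)) q
  have htail (t : ℕ) (c : Fin (n + 2)) (R : ℕ) (h : (c : ℕ) ∈ K ∧ (c : ℕ) + t + R ≤ n + d) :
      R + (x - d + t) ≤ n * ∑ c' with c < c', q c' :=
    tail_weight_ge hn0 (fun k hk => (hmemK k).1 hk) hp1 hcol h.1 h.2
  set B : ℕ → Fin (n + 2) → ℕ → Prop := fun t c R => (c : ℕ) ∈ K ∧ (c : ℕ) + t + R ≤ n + d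
    with hB
  have hfinal := hsum N (fun t => ∑ f : Fin n → Fin (n + 2), (∏ i, q (f i)) *
      (if ∃ c : Fin (n + 2), B t c #{i | c < f i} then 1 else 0)) ?_
    (fun t ht ht' => by convert iid_crossing_le (B := B t) ht ht' hq0 hq1 (htail t))
    (fun t ht ht' => by convert iid_crossing_le_rpow (B := B t) ht ht' hq0 hq1 (htail t))
  · have h : d * ∑ f : Fin n → Fin (n + 2), (∏ i, p i (f i)) *
        (if ∃ k : ℕ, x < k ∧ k ≤ n ∧ k ≤ #{i | (f i : ℕ) ≤ k} then 1 else 0) ≤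
        d * Real.exp (1 - 2 * x ^ 2 / n) := (hstep1.trans (hstep2.trans_eq hstep3)).trans hfinal
    exact le_of_mul_le_mul_left h hd0
  · intro t ht
    refine (Finset.sum_eq_zero fun f _ => ?_).le
    rw [if_neg, mul_zero]
    rintro ⟨c, hc, h⟩
    obtain ⟨hcn, hcx⟩ := (hmemK _).1 hc
    have h' : ((c : ℕ) : ℝ) + t ≤ n + d := by exact_mod_cast (le_self_add.trans h)
    linarith

/-! ### The one-sided Bretagnolle inequality -/

/-- The points of `[0, 1]` at which the sum of the bounding functions is less than `k - x`. -/
def lowSet {n : ℕ} (F : Fin n → ℝ → ℝ) (x : ℝ) (k : ℕ) : Set ℝ :=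
  {s | s ∈ Set.Icc (0 : ℝ) 1 ∧ ∑ i, F i s < k - x}

lemma lowSet_mono {n : ℕ} (F : Fin n → ℝ → ℝ) (x : ℝ) : Monotone (lowSet F x) := by
  rintro k l hkl s ⟨h1, h2⟩
  have : (k : ℝ) ≤ l := Nat.cast_le.2 hkl
  exact ⟨h1, by linarith⟩

lemma mem_lowSet_of_le {n : ℕ} {F : Fin n → ℝ → ℝ} (hF : ∀ i, Monotone (F i)) {x : ℝ} {k : ℕ}
    {s t : ℝ} (ht : t ∈ lowSet F x k) (hs : 0 ≤ s) (hst : s ≤ t) : s ∈ lowSet F x k :=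
  ⟨⟨hs, hst.trans ht.1.2⟩, (Finset.sum_le_sum fun i _ => hF i hst).trans_lt ht.2⟩

lemma measurableSet_lowSet {n : ℕ} {F : Fin n → ℝ → ℝ} (hF : ∀ i, Monotone (F i)) (x : ℝ)
    (k : ℕ) : MeasurableSet (lowSet F x k) := by
  refine Set.OrdConnected.measurableSet ⟨fun a ha b hb c hc => ?_⟩
  exact mem_lowSet_of_le hF hb (ha.1.1.trans hc.1) hc.2

/-- The expected number of points in `lowSet F x k` is at most `k - x`, by continuity from below
along a sequence that is cofinal in this set. -/
lemma sum_measureReal_lowSet_le {Ω : Type*} [MeasurableSpace Ω] {P : Measure Ω}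
    [IsProbabilityMeasure P] {n : ℕ} {Y : Fin n → Ω → ℝ} {F : Fin n → ℝ → ℝ}
    (hPF : ∀ i t, P.real {ω | Y i ω ≤ t} ≤ F i t) {x : ℝ} {k : ℕ} (hk : x < k) :
    ∑ i, P.real (Y i ⁻¹' lowSet F x k) ≤ k - x := by
  rcases (lowSet F x k).eq_empty_or_nonempty with hT | hT
  · simp only [hT, Set.preimage_empty, measureReal_empty, Finset.sum_const_zero]
    linarith
  obtain ⟨u, hu, humem, hcof⟩ : ∃ u : ℕ → ℝ, Monotone u ∧
      (∀ m, u m ∈ lowSet F x k) ∧ ∀ s ∈ lowSet F x k, ∃ m, s ≤ u m := by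
    have hlub : IsLUB (lowSet F x k) (sSup (lowSet F x k)) :=
      isLUB_csSup hT ⟨1, fun s hs => hs.1.2⟩
    by_cases hmem : sSup (lowSet F x k) ∈ lowSet F x k
    · exact ⟨fun _ => sSup (lowSet F x k), monotone_const, fun _ => hmem,
        fun s hs => ⟨0, hlub.1 hs⟩⟩
    · obtain ⟨u, hu, -, hlim, humem⟩ := hlub.exists_seq_strictMono_tendsto_of_notMem hmem hT
      refine ⟨u, hu.monotone, humem, fun s hs => ?_⟩
      have hlt : s < sSup (lowSet F x k) :=
        lt_of_le_of_ne (hlub.1 hs) fun h => hmem (h ▸ hs)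
      exact ((hlim.eventually_const_lt hlt).exists).imp fun m hm => hm.le
  have hlim (i : Fin n) : Tendsto (fun m => P.real {ω | Y i ω ≤ u m}) atTop
      (𝓝 (P.real (⋃ m, {ω | Y i ω ≤ u m}))) :=
    (ENNReal.tendsto_toReal (measure_ne_top P _)).comp (tendsto_measure_iUnion_atTop
      fun a b hab ω (hω : Y i ω ≤ u a) => show Y i ω ≤ u b from hω.trans (hu hab))
  have hle : ∑ i, P.real (⋃ m, {ω | Y i ω ≤ u m}) ≤ k - x :=
    le_of_tendsto (tendsto_finsetSum _ fun i _ => hlim i) (Eventually.of_forall fun m =>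
      (Finset.sum_le_sum fun i _ => hPF i (u m)).trans (humem m).2.le)
  refine le_trans (Finset.sum_le_sum fun i _ => measureReal_mono fun ω hω => ?_) hle
  obtain ⟨m, hm⟩ := hcof _ hω
  exact Set.mem_iUnion.2 ⟨m, hm⟩

open scoped Classical in
/-- The least `k ≤ n` such that `s` lies in the `k`-th of the increasing sets `lowSet F x k`, and
`n + 1` if there is none. -/
noncomputable def cell {n : ℕ} (F : Fin n → ℝ → ℝ) (x s : ℝ) : Fin (n + 2) :=
  ⟨#{k ∈ range (n + 1) | s ∉ lowSet F x k}, Nat.lt_succ_of_le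
    ((Finset.card_filter_le _ _).trans_eq (Finset.card_range _))⟩

open scoped Classical in
lemma cell_le_iff {n : ℕ} (F : Fin n → ℝ → ℝ) (x s : ℝ) {k : ℕ} (hk : k ≤ n) :
    (cell F x s : ℕ) ≤ k ↔ s ∈ lowSet F x k := by
  constructor
  · intro h
    by_contra hs
    have h1 : range (k + 1) ⊆ {l ∈ range (n + 1) | s ∉ lowSet F x l} := by
      intro l hl
      rw [Finset.mem_range] at hl
      exact Finset.mem_filter.2 ⟨Finset.mem_range.2 (by omega),
        fun hl' => hs (lowSet_mono F x (by omega) hl')⟩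
    have h2 := Finset.card_le_card h1
    rw [Finset.card_range] at h2
    have h3 : k + 1 ≤ (cell F x s : ℕ) := h2
    omega
  · intro hs
    have h1 : ({l ∈ range (n + 1) | s ∉ lowSet F x l} : Finset ℕ) ⊆ range k := by
      intro l hl
      rw [Finset.mem_range]
      by_contra hlk
      exact (Finset.mem_filter.1 hl).2 (lowSet_mono F x (by omega) hs)
    have h2 := Finset.card_le_card h1
    rw [Finset.card_range] at h2
    exact h2

open scoped Classical in
lemma measurable_cell {n : ℕ} {F : Fin n → ℝ → ℝ} (hF : ∀ i, Monotone (F i)) (x : ℝ) :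
    Measurable (cell F x) := by
  have h1 : Measurable fun s => (cell F x s : ℕ) := by
    have h2 : (fun s => (cell F x s : ℕ)) =
        fun s => ∑ k ∈ range (n + 1), if s ∈ (lowSet F x k)ᶜ then 1 else 0 := by
      ext s
      rw [← Finset.card_filter]
      simp only [cell, Set.mem_compl_iff]
    rw [h2]
    exact Finset.measurable_sum _ fun k _ =>
      Measurable.ite (measurableSet_lowSet hF x k).compl measurable_const measurable_const
  refine measurable_to_countable' fun c => ?_
  have h3 : cell F x ⁻¹' {c} = (fun s => (cell F x s : ℕ)) ⁻¹' {(c : ℕ)} := by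
    ext s
    simp [Fin.ext_iff]
  rw [h3]
  exact h1 (measurableSet_singleton _)

/-- The one-sided Bretagnolle inequality for independent variables with heterogeneous
distributions, which are stochastically bounded below by the distributions with cumulative
distribution functions `F i`. -/
theorem exists_bretagnolle_event {Ω : Type*} [MeasurableSpace Ω] (P : Measure Ω)
    [IsProbabilityMeasure P] {n : ℕ} {Y : Fin n → Ω → ℝ} (hY : ∀ i, Measurable (Y i))
    (hY0 : ∀ i ω, 0 ≤ Y i ω) (hind : iIndepFun Y P) {F : Fin n → ℝ → ℝ}
    (hF : ∀ i, Monotone (F i)) (hF0 : ∀ i, ∀ t ∈ Set.Icc (0 : ℝ) 1, 0 ≤ F i t)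
    (hPF : ∀ i t, P.real {ω | Y i ω ≤ t} ≤ F i t) {x : ℝ} (hx0 : 0 ≤ x)
    (hx : (n : ℝ) ≤ 2 * x ^ 2) :
    ∃ E : Set Ω, P E ≤ ENNReal.ofReal (Real.exp (1 - 2 * x ^ 2 / n)) ∧
      ∀ ω ∉ E, ∀ t ∈ Set.Icc (0 : ℝ) 1,
        ∑ i, ((if Y i ω ≤ t then 1 else 0) - F i t) ≤ x := by
  classical
  have hsum (ω : Ω) (t : ℝ) : ∑ i, ((if Y i ω ≤ t then 1 else 0) - F i t) =
      (#{i | Y i ω ≤ t} : ℝ) - ∑ i, F i t := by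
    rw [Finset.sum_sub_distrib, Finset.card_filter]
    push_cast
    rfl
  have hcard (ω : Ω) (t : ℝ) : #{i | Y i ω ≤ t} ≤ n :=
    (Finset.card_le_univ _).trans_eq (Fintype.card_fin n)
  rcases le_or_gt (n : ℝ) x with hxn | hxn
  · refine ⟨∅, by simp, fun ω _ t ht => ?_⟩
    rw [hsum]
    have h1 : (0 : ℝ) ≤ ∑ i, F i t := Finset.sum_nonneg fun i _ => hF0 i t ht
    have h2 : (#{i | Y i ω ≤ t} : ℝ) ≤ n := Nat.cast_le.2 (hcard ω t)
    linarith
  have hx0' : 0 < x := by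
    rcases hx0.lt_or_eq with h | h
    · exact h
    · subst h
      have : (n : ℝ) ≤ 0 := by simpa using hx
      linarith
  set Z : Fin n → Ω → Fin (n + 2) := fun i ω => cell F x (Y i ω) with hZ
  have hZm (i : Fin n) : Measurable (Z i) := (measurable_cell hF x).comp (hY i)
  have hZind : iIndepFun Z P := hind.comp (fun _ => cell F x) fun _ => measurable_cell hF x
  set p : Fin n → Fin (n + 2) → ℝ := fun i c => P.real (Z i ⁻¹' {c}) with hp
  have hpre (i : Fin n) (S : Finset (Fin (n + 2))) : ∑ c ∈ S, p i c = P.real (Z i ⁻¹' S) := by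
    rw [hp, ← sum_measureReal_preimage_singleton S fun c _ => hZm i (measurableSet_singleton c)]
  have hp1 (i : Fin n) : ∑ c, p i c = 1 := by
    rw [hpre]
    simp
  have hcol (k : ℕ) (hk : x < k) (hkn : k ≤ n) :
      ∑ i, ∑ c ∈ univ.filter (fun c : Fin (n + 2) => (c : ℕ) ≤ k), p i c ≤ k - x := by
    refine le_of_eq_of_le (Finset.sum_congr rfl fun i _ => ?_) (sum_measureReal_lowSet_le hPF hk)
    rw [hpre]
    congr 1
    ext ω
    simp only [hZ, Set.mem_preimage, Finset.coe_filter, Finset.mem_univ, true_and,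
      Set.mem_ofPred_eq]
    exact cell_le_iff F x _ hkn
  have hmain := crossing_prob_le_exp hx0' hx hxn (fun i c => measureReal_nonneg) hp1 hcol
  set Φ : (Fin n → Fin (n + 2)) → Prop :=
    fun f => ∃ k : ℕ, x < k ∧ k ≤ n ∧ k ≤ #{i | (f i : ℕ) ≤ k} with hΦ
  refine ⟨{ω | Φ fun i => Z i ω}, ?_, fun ω hω t ht => ?_⟩
  · have hcover : {ω | Φ fun i => Z i ω} ⊆
        ⋃ f ∈ univ.filter Φ, ⋂ i ∈ (univ : Finset (Fin n)), Z i ⁻¹' {f i} := by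
      intro ω hω
      simp only [Set.mem_iUnion]
      exact ⟨fun i => Z i ω, Finset.mem_filter.2 ⟨Finset.mem_univ _, hω⟩, by simp⟩
    refine ((measure_mono hcover).trans (measure_biUnion_finset_le _ _)).trans ?_
    have hprod (f : Fin n → Fin (n + 2)) :
        P (⋂ i ∈ (univ : Finset (Fin n)), Z i ⁻¹' {f i}) =
          ENNReal.ofReal (∏ i, p i (f i)) := by
      rw [hZind.measure_inter_preimage_eq_mul univ fun i _ => measurableSet_singleton (f i),
        ENNReal.ofReal_prod_of_nonneg fun i _ => measureReal_nonneg]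
      exact Finset.prod_congr rfl fun i _ => by simp
    simp only [hprod]
    rw [← ENNReal.ofReal_sum_of_nonneg fun f _ => Finset.prod_nonneg fun i _ => measureReal_nonneg,
      Finset.sum_filter]
    refine ENNReal.ofReal_le_ofReal (le_of_eq_of_le ?_ hmain)
    refine Finset.sum_congr rfl fun f _ => ?_
    rw [mul_ite, mul_one, mul_zero]
  · rw [hsum]
    by_contra hgt
    rw [not_le] at hgt
    refine hω ⟨#{i | Y i ω ≤ t}, ?_, hcard ω t, ?_⟩
    · have h1 : (0 : ℝ) ≤ ∑ i, F i t := Finset.sum_nonneg fun i _ => hF0 i t ht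
      linarith
    · refine Finset.card_le_card fun i hi => ?_
      simp only [Finset.mem_filter, Finset.mem_univ, true_and] at hi ⊢
      rw [hZ, cell_le_iff F x _ (hcard ω t)]
      exact mem_lowSet_of_le hF ⟨ht, by linarith⟩ (hY0 i ω) hi

/-! ### From the deviation bound to false discoveries -/

lemma val_le_of_strictMono {n m : ℕ} {f : Fin n → Fin m} (hf : StrictMono f) (k : Fin n) :
    (k : ℕ) ≤ f k := by
  obtain ⟨k, hk⟩ := k
  induction k with
  | zero => exact Nat.zero_le _
  | succ k ih =>
    have h1 := ih (by omega)
    have h2 : f ⟨k, by omega⟩ < f ⟨k + 1, hk⟩ := hf (Fin.mk_lt_mk.2 (Nat.lt_succ_self k))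
    have h3 := Fin.lt_def.1 h2
    simp only at h1 ⊢
    omega

/-- The first `#B` values of a nondecreasing vector have the smallest sum among all families of
`#B` of its values. -/
lemma sum_lt_card_le_sum {m : ℕ} {y : Fin m → ℝ} (hy : Monotone y) (B : Finset (Fin m)) :
    ∑ j ∈ univ.filter (fun j : Fin m => (j : ℕ) < #B), y j ≤ ∑ j ∈ B, y j := by
  have hBm : #B ≤ m := (Finset.card_le_univ _).trans_eq (Fintype.card_fin m)
  have h1 : ∑ j ∈ univ.filter (fun j : Fin m => (j : ℕ) < #B), y j =
      ∑ k : Fin #B, y (Fin.castLE hBm k) := by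
    symm
    refine Finset.sum_bij (fun k _ => Fin.castLE hBm k) ?_ ?_ ?_ ?_
    · intro k _
      simp
    · intro a _ b _ h
      exact Fin.castLE_injective hBm h
    · intro j hj
      exact ⟨⟨j, (Finset.mem_filter.1 hj).2⟩, Finset.mem_univ _, rfl⟩
    · intro k _
      rfl
  have h2 : ∑ j ∈ B, y j = ∑ k : Fin #B, y (B.orderEmbOfFin rfl k) := by
    have h3 := Finset.sum_map univ (B.orderEmbOfFin rfl).toEmbedding y
    rwa [Finset.map_orderEmbOfFin_univ] at h3
  rw [h1, h2]
  refine Finset.sum_le_sum fun k _ => hy ?_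
  exact Fin.le_def.2 (val_le_of_strictMono (B.orderEmbOfFin rfl).strictMono k)

lemma orderStat_mono {m : ℕ} (x : Fin m → ℝ) : Monotone (orderStat x) := Tuple.monotone_sort x

lemma sum_orderStat_le_sum {m : ℕ} (x : Fin m → ℝ) (A : Finset (Fin m)) :
    ∑ j ∈ univ.filter (fun j : Fin m => (j : ℕ) < #A), orderStat x j ≤ ∑ i ∈ A, x i := by
  have h := sum_lt_card_le_sum (orderStat_mono x) (A.map (Tuple.sort x).symm.toEmbedding)
  rw [Finset.card_map, Finset.sum_map] at h
  simpa [orderStat] using h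

lemma sum_le_sum_revOrderStat {m : ℕ} (x : Fin m → ℝ) (A : Finset (Fin m)) :
    ∑ i ∈ A, x i ≤ ∑ j ∈ univ.filter (fun j : Fin m => (j : ℕ) < #A), revOrderStat x j := by
  have hmono : Monotone fun j => -revOrderStat x j := fun i j hij =>
    neg_le_neg (orderStat_mono x (Fin.rev_le_rev.2 hij))
  have h := sum_lt_card_le_sum hmono
    (A.map ((Tuple.sort x).symm.trans Fin.revPerm).toEmbedding)
  rw [Finset.card_map, Finset.sum_map, Finset.sum_neg_distrib, Finset.sum_neg_distrib,
    neg_le_neg_iff] at h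
  simpa [revOrderStat, orderStat] using h

lemma lam_nonneg (α : ℝ) : 0 ≤ lam α := Real.sqrt_nonneg _

lemma two_mul_lam_sq {α : ℝ} (hα : α ∈ Set.Ioc (0 : ℝ) 1) :
    2 * lam α ^ 2 = 1 - Real.log α ∧ 1 ≤ 2 * lam α ^ 2 := by
  have h1 : Real.log α ≤ 0 := Real.log_nonpos hα.1.le hα.2
  have h2 : lam α ^ 2 = (1 - Real.log α) / 2 := by
    rw [lam, one_div, Real.log_inv, Real.sq_sqrt (by linarith)]
    ring
  constructor <;> linarith

/-- The deterministic core of the plug-in inequality: whenever the process stays below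
`√m₀ λ` and `m₀ ≤ M`, the number of null p-values up to `t` is at most the plug-in envelope. -/
lemma countLE_le_envelope {m : ℕ} {F : Fin m → ℝ → ℝ}
    (hF0 : ∀ i, ∀ t ∈ Set.Icc (0 : ℝ) 1, 0 ≤ F i t) {α : ℝ} {q : Fin m → ℝ} {A : Finset (Fin m)}
    {t : ℝ} (ht : t ∈ Set.Icc (0 : ℝ) 1) (h : ∑ k ∈ A, G F q t k ≤ √(#A : ℝ) * lam α) {M : ℕ}
    (hM : #A ≤ M) : (countLE q A t : ℝ) ≤ envelope F α M t := by
  have h1 : ∑ k ∈ A, G F q t k = countLE q A t - ∑ k ∈ A, F k t := by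
    simp only [G, countLE, Finset.sum_sub_distrib, Finset.card_filter]
    push_cast
    rfl
  have h2 := sum_le_sum_revOrderStat (fun i => F i t) A
  have h3 : ∑ j ∈ univ.filter (fun j : Fin m => (j : ℕ) < #A), revOrderStat (fun i => F i t) j ≤
      ∑ j ∈ univ.filter (fun j : Fin m => (j : ℕ) < M), revOrderStat (fun i => F i t) j := by
    refine Finset.sum_le_sum_of_subset_of_nonneg (fun j hj => ?_) fun j _ _ => hF0 _ t ht
    rw [Finset.mem_filter] at hj ⊢
    exact ⟨hj.1, hj.2.trans_le hM⟩
  have h4 : √(#A : ℝ) * lam α ≤ √(M : ℝ) * lam α :=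
    mul_le_mul_of_nonneg_right (Real.sqrt_le_sqrt (Nat.cast_le.2 hM)) (lam_nonneg α)
  rw [envelope]
  linarith

lemma card_le_mHat {m : ℕ} {F : Fin m → ℝ → ℝ} {α : ℝ} {q : Fin m → ℝ} {A : Finset (Fin m)}
    (h : ∀ t ∈ Set.Icc (0 : ℝ) 1, ∑ k ∈ A, G F q t k ≤ √(#A : ℝ) * lam α) :
    #A ≤ mHat F α q := by
  have hA : #A ≤ m := (Finset.card_le_univ _).trans_eq (Fintype.card_fin m)
  rw [mHat]
  refine Finset.le_sup (f := id) ?_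
  simp only [Finset.mem_filter, Finset.mem_range]
  refine ⟨Nat.lt_succ_of_le hA, fun t ht => ?_⟩
  rw [mul_comm]
  exact (sum_orderStat_le_sum _ A).trans (h t ht)

lemma card_topSet_inter_le_zeta {m : ℕ} {F : Fin m → ℝ → ℝ}
    (hF0 : ∀ i, ∀ t ∈ Set.Icc (0 : ℝ) 1, 0 ≤ F i t) {α : ℝ} {q : Fin m → ℝ}
    (hq : ∀ i, q i ∈ Set.Icc (0 : ℝ) 1) {A : Finset (Fin m)}
    (h : ∀ t ∈ Set.Icc (0 : ℝ) 1, ∑ k ∈ A, G F q t k ≤ √(#A : ℝ) * lam α)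
    {σ : Equiv.Perm (Fin m)} (hσ : Monotone fun k => q (σ k)) (k : Fin m) :
    #(topSet σ k ∩ A) ≤ zeta F α q k := by
  have hA := card_le_mHat h
  refine le_min ?_ (le_min ((Finset.card_le_card Finset.inter_subset_right).trans hA) ?_)
  · refine (Finset.card_le_card Finset.inter_subset_left).trans (Finset.card_image_le.trans ?_)
    have : (univ.filter fun j : Fin m => j ≤ k) = Finset.Iic k := by ext j; simp
    rw [this, Fin.card_Iic]
  · have ht : orderStat q k ∈ Set.Icc (0 : ℝ) 1 := hq _
    refine Nat.le_floor ((Nat.cast_le.2 (Finset.card_le_card fun i hi => ?_)).trans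
      (countLE_le_envelope hF0 ht (h _ ht) hA))
    rw [Finset.mem_inter, topSet, Finset.mem_image] at hi
    obtain ⟨⟨j, hj, rfl⟩, hiA⟩ := hi
    have h1 : q ∘ σ = q ∘ Tuple.sort q := Tuple.comp_sort_eq_comp_iff_monotone.2 hσ
    have h2 : q (σ k) = orderStat q k := congrFun h1 k
    exact Finset.mem_filter.2 ⟨hiA, h2 ▸ hσ (Finset.mem_filter.1 hj).2⟩

lemma card_inter_le_jerBound {m : ℕ} {κ : Type*} {R : κ → Finset (Fin m)} {ζ : κ → ℕ}
    {A : Finset (Fin m)} (h : ∀ k, #(R k ∩ A) ≤ ζ k) (S : Finset (Fin m)) :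
    #(S ∩ A) ≤ jerBound R ζ S := by
  classical
  rw [jerBound]
  exact Finset.le_sup (f := fun A => #(S ∩ A)) (Finset.mem_filter.2 ⟨Finset.mem_univ A, by
    intro k; convert h k⟩)

/-- The uniform deviation event for the true null hypotheses has probability at most `α`. -/
lemma exists_deviation_event {𝓧 : Type*} [MeasurableSpace 𝓧] {m : ℕ}
    {𝔉 : Set (ProbabilityMeasure 𝓧)} {H : Fin m → Set (ProbabilityMeasure 𝓧)}
    {p : Fin m → 𝓧 → ℝ} (hp : ∀ i, Measurable (p i))
    (hp01 : ∀ i x, p i x ∈ Set.Icc (0 : ℝ) 1) {F : Fin m → ℝ → ℝ}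
    (hindep : IndepUnderNull 𝔉 H p) (hhet : HeterogeneousBound 𝔉 H p F)
    (hF0 : ∀ i, ∀ t ∈ Set.Icc (0 : ℝ) 1, 0 ≤ F i t) {α : ℝ} (hα : α ∈ Set.Ioc (0 : ℝ) 1)
    {μ : ProbabilityMeasure 𝓧} (hμ : μ ∈ 𝔉) {Ω : Type*} [MeasurableSpace Ω] {P : Measure Ω}
    {X : Ω → 𝓧} (hX : Measurable X) (hlaw : P.map X = (μ : Measure 𝓧)) :
    ∃ E : Set Ω, P E ≤ ENNReal.ofReal α ∧ ∀ ω ∉ E, ∀ t ∈ Set.Icc (0 : ℝ) 1,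
      ∑ k ∈ trueNulls H μ, G F (fun i => p i (X ω)) t k ≤
        √(#(trueNulls H μ) : ℝ) * lam α := by
  set A := trueNulls H μ with hA
  rcases Nat.eq_zero_or_pos #A with h0 | h0
  · refine ⟨∅, by simp, fun ω _ t _ => ?_⟩
    rw [Finset.card_eq_zero.1 h0]
    simp
  set n := #A with hn
  have hnR : (0 : ℝ) < n := Nat.cast_pos.2 h0
  set e : Fin n ≃ A := (A.equivFin).symm with he
  obtain ⟨hlam1, hlam2⟩ := two_mul_lam_sq hα
  have hx2 : (√(n : ℝ) * lam α) ^ 2 = n * lam α ^ 2 := by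
    rw [mul_pow, Real.sq_sqrt hnR.le]
  obtain ⟨E, hE, hgood⟩ := exists_bretagnolle_event (μ : Measure 𝓧)
    (Y := fun i : Fin n => p (e i)) (fun i => hp _) (fun i ω => (hp01 _ ω).1)
    ((hindep μ hμ).precomp e.injective) (F := fun i => F (e i)) (fun i => hhet.1 _)
    (fun i => hF0 _) (fun i t => hhet.2 μ hμ _ (e i).2 t) (x := √(n : ℝ) * lam α)
    (mul_nonneg (Real.sqrt_nonneg _) (lam_nonneg α)) (by rw [hx2]; nlinarith)
  refine ⟨X ⁻¹' E, ?_, fun ω hω t ht => ?_⟩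
  · refine ((Measure.le_map_apply hX.aemeasurable E).trans_eq (by rw [hlaw])).trans
      (hE.trans_eq ?_)
    have h1 : 1 - 2 * (√(n : ℝ) * lam α) ^ 2 / n = Real.log α := by
      rw [hx2, mul_left_comm, mul_div_cancel_left₀ _ hnR.ne', hlam1]
      ring
    rw [h1, Real.exp_log hα.1]
  · refine le_of_eq_of_le ?_ (hgood (X ω) hω t ht)
    rw [← Finset.sum_coe_sort A, ← Equiv.sum_comp e]
    simp only [G]

end FDBound

theorem mainTheorem6 {𝓧 : Type*} [MeasurableSpace 𝓧] {m : ℕ}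
    (𝔉 : Set (ProbabilityMeasure 𝓧)) (H : Fin m → Set (ProbabilityMeasure 𝓧))
    (p : Fin m → 𝓧 → ℝ) (hp : ∀ i, Measurable (p i))
    (hp01 : ∀ i x, p i x ∈ Set.Icc (0 : ℝ) 1)
    (F : Fin m → ℝ → ℝ)
    (hindep : FDBound.IndepUnderNull 𝔉 H p)
    (hhet : FDBound.HeterogeneousBound 𝔉 H p F)
    (hF0 : ∀ i, ∀ t ∈ Set.Icc (0 : ℝ) 1, 0 ≤ F i t)
    (α : ℝ) (hα : α ∈ Set.Ioc (0 : ℝ) 1)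
    (μ : ProbabilityMeasure 𝓧) (hμ : μ ∈ 𝔉)
    {Ω : Type*} [MeasurableSpace Ω] (P : Measure Ω) [IsProbabilityMeasure P]
    (X : Ω → 𝓧) (hX : Measurable X) (hlaw : P.map X = (μ : Measure 𝓧)) :
    -- the adaptive plug-in inequality
    (∀ m₀hat : Ω → ℕ, (∀ ω, m₀hat ω ≤ m) →
      {ω | ∀ t ∈ Set.Icc (0 : ℝ) 1,
          ∑ k ∈ FDBound.trueNulls H μ, FDBound.G F (fun i => p i (X ω)) t k
            ≤ √((FDBound.trueNulls H μ).card : ℝ) * FDBound.lam α}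
        ⊆ {ω | (FDBound.trueNulls H μ).card ≤ m₀hat ω} →
      P {ω | ∃ t ∈ Set.Icc (0 : ℝ) 1,
          FDBound.envelope F α (m₀hat ω) t
            < (FDBound.countLE (fun i => p i (X ω)) (FDBound.trueNulls H μ) t : ℝ)}
        ≤ ENNReal.ofReal α) ∧
    -- the adaptive top-k confidence bound
    (∀ σ : Ω → Equiv.Perm (Fin m),
      (∀ ω, Monotone fun k => p (σ ω k) (X ω)) →
      FDBound.IsFDConfidenceBound P (FDBound.trueNulls H μ) α fun ω =>
        FDBound.jerBound (FDBound.topSet (σ ω)) (FDBound.zeta F α fun i => p i (X ω))) := by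
  obtain ⟨E, hE, hgood⟩ :=
    FDBound.exists_deviation_event hp hp01 hindep hhet hF0 hα hμ hX hlaw
  refine ⟨fun m₀hat _ hm₀ => ?_, fun σ hσ => ?_⟩
  · refine (measure_mono fun ω hω => ?_).trans hE
    by_contra hωE
    obtain ⟨t, ht, hlt⟩ := hω
    exact hlt.not_ge (FDBound.countLE_le_envelope hF0 ht (hgood ω hωE t ht)
      (hm₀ (hgood ω hωE)))
  · have hbound : ∀ ω ∉ E, ∀ S : Finset (Fin m), (S ∩ FDBound.trueNulls H μ).card ≤
        FDBound.jerBound (FDBound.topSet (σ ω)) (FDBound.zeta F α fun i => p i (X ω)) S :=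
      fun ω hω => FDBound.card_inter_le_jerBound fun k =>
        FDBound.card_topSet_inter_le_zeta hF0 (fun i => hp01 i (X ω)) (hgood ω hω) (hσ ω) k
    constructor
    -- The event need not be measurable, so that subadditivity replaces the complement rule.
    · have h1 : (1 : ENNReal) ≤ P E + P Eᶜ := by
        rw [← measure_univ (μ := P), ← Set.union_compl_self E]
        exact measure_union_le _ _
      rw [ENNReal.ofReal_sub _ hα.1.le, ENNReal.ofReal_one, tsub_le_iff_left]
      exact h1.trans (add_le_add hE (measure_mono fun ω hω => hbound ω hω))
    · refine (measure_mono fun ω hω => ?_).trans hE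
      by_contra hωE
      obtain ⟨S, hS⟩ := hω
      exact hS.not_ge (hbound ω hωE S)
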